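/- Let $\mathbb X$ (separable), $\mathbb U$ and $\mathbb K$ be real Hilbert spaces, let $\tau>0$, $\rho\in\mathbb R$, $x_0\in\mathbb X$, $K_{ad}\subset\mathbb K$, and let $U_{ad}=\{u\in L^2(0,\tau;\mathbb U):\|u\|_{2}\le\rho\}$. Assume: (i) the operator $A$ with domain $D(A)\subset\mathbb X$ generates a strongly continuous semigroup $T(t)$ on $\mathbb X$; (ii) $F:\mathbb X\to\mathbb X$ is Gâteaux differentiable with derivative $F'_x\in\mathcal L(\mathbb X)$ at $x$, and $x\mapsto F'_x$ maps bounded sets to bounded sets; (iii) for $r\in K_{ad}$, $B(r)\in\mathcal L(\mathbb U,\mathbb X)$; the map $r\mapsto B(r)$ from $K_{ad}$ to $\mathcal L(\mathbb U,\mathbb X)$ is Gâteaux differentiable on $K_{ad}$, with derivative $B'_r\in\mathcal L(\mathbb K,\mathcal L(\mathbb U,\mathbb X))$ (at each $r\in K_{ad}$ and in each direction, the derivative being taken along those increments that stay in $K_{ad}$), and $r\mapsto B'_r$ maps bounded subsets of $K_{ad}$ to bounded sets; (iv) $Q\in\mathcal L(\mathbb X)$ is self-adjoint and positive semi-definite,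 and $R\in\mathcal L(\mathbb U)$ is self-adjoint and positive definite, i.e. $\langle Ru,u\rangle>0$ for $u\ne0$; $R^{-1}:\operatorname{ran}R\to\mathbb U$ is its inverse. For $u\in L^2(0,\tau;\mathbb U)$ and $r\in K_{ad}$, a mild solution of $\dot x=Ax+F(x)+B(r)u$, $x(0)=x_0$, is an $x\in C([0,\tau];\mathbb X)$ with $$x(t)=T(t)x_0+\int_0^tT(t-s)F(x(s))\,ds+\int_0^tT(t-s)B(r)u(s)\,ds,\qquad 0\le t\le\tau .$$ Let $(u^o,r^o)\in U_{ad}\times K_{ad}$, with a mild solution $x^o$, be a local minimizer, in the norm topology of $L^2(0,\tau;\mathbb U)\times\mathbb K$, of the cost $$J=\int_0^\tau\langle Qx(t),x(t)\rangle+\langle Ru(t),u(t)\rangle\,dt$$ over all $u\in U_{ad}$, $r\in K_{ad}$ and corresponding mild solutions $x$, and suppose that $(u^o,r^o)$ lies in the interior of $U_{ad}\times K_{ad}$. Let $p^o\in C([0,\tau];\mathbb X)$ be the mild solution of $$\dot p^o(t)=-(A^*+F'^*_{x^o(t)})p^o(t)-Qx^o(t),\quad p^o(\tau)=0,$$ that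 is, $p^o(t)=\int_t^\tau T(s-t)^*\big(F'^*_{x^o(s)}p^o(s)+Qx^o(s)\big)ds$ for $0\le t\le\tau$. Then, for almost every $t\in(0,\tau)$, $B(r^o)^*p^o(t)\in\operatorname{ran}R$ and $$u^o(t)=-R^{-1}B(r^o)^*p^o(t),$$ and the function $t\mapsto(B'_{r^o}u^o(t))^*p^o(t)$ is integrable on $(0,\tau)$ with $$\int_0^\tau (B'_{r^o}u^o(t))^*p^o(t)\,dt=0,$$ where, for $u\in\mathbb U$, $(B'_{r^o}u)^*:\mathbb X\to\mathbb K$ is defined by $\langle(B'_{r^o}u)^*p,h\rangle_{\mathbb K}=\langle p,(B'_{r^o}h)u\rangle$ for all $p\in\mathbb X$, $h\in\mathbb K$. -/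

import Mathlib

open MeasureTheory Set Filter Topology
open scoped InnerProductSpace InnerProduct ENNReal

namespace ActuatorDesign

noncomputable section

/-- `T`, used only at times `t ≥ 0`, is a strongly continuous semigroup of bounded operators. -/
structure IsC0Semigroup {X : Type*} [NormedAddCommGroup X] [NormedSpace ℝ X]
    (T : ℝ → X →L[ℝ] X) : Prop where
  map_zero : T 0 = ContinuousLinearMap.id ℝ X
  map_add : ∀ s t : ℝ, 0 ≤ s → 0 ≤ t → T (s + t) = (T s).comp (T t)
  strongly_continuous : ∀ x : X, ContinuousOn (fun t => T t x) (Ici 0)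

/-- The (in general unbounded) operator `A` with domain `D(A)` is the infinitesimal generator of
the strongly continuous semigroup `T`: `x ∈ D(A)` and `A x = y` exactly when
`(T h x - x) / h → y` as `h → 0+`. -/
def Generates {X : Type*} [NormedAddCommGroup X] [NormedSpace ℝ X]
    (A : X →ₗ.[ℝ] X) (T : ℝ → X →L[ℝ] X) : Prop :=
  IsC0Semigroup T ∧
    ∀ x y : X, (x, y) ∈ A.graph ↔
      Tendsto (fun h : ℝ => h⁻¹ • (T h x - x)) (𝓝[>] 0) (𝓝 y)

/-- Gâteaux differentiability on the whole space: `f' x` is a bounded linear operator whose value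
at `h` is the directional derivative of `f` at `x` along `h`. -/
def HasGateauxDeriv {E G : Type*} [NormedAddCommGroup E] [NormedSpace ℝ E]
    [NormedAddCommGroup G] [NormedSpace ℝ G] (f : E → G) (f' : E → E →L[ℝ] G) : Prop :=
  ∀ x h : E, HasLineDerivAt ℝ f (f' x h) x h

/-- Gâteaux differentiability on a set `S`; only values of `f` on `S` matter. At interior
points of `S` this is the usual notion. -/
def HasGateauxDerivOn {E G : Type*} [NormedAddCommGroup E] [NormedSpace ℝ E]
    [NormedAddCommGroup G] [NormedSpace ℝ G] (f : E → G) (f' : E → E →L[ℝ] G)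
    (S : Set E) : Prop :=
  ∀ x ∈ S, ∀ h : E, HasLineDerivWithinAt ℝ f (f' x h) S x h

/-- A map sends bounded subsets of `S` to bounded sets. -/
def MapsBoundedOn {E G : Type*} [NormedAddCommGroup E] [NormedAddCommGroup G]
    (g : E → G) (S : Set E) : Prop :=
  ∀ V ⊆ S, Bornology.IsBounded V → Bornology.IsBounded (g '' V)

/-- A positive definite self-adjoint bounded operator. -/
def IsPositiveDefinite {U : Type*} [NormedAddCommGroup U] [InnerProductSpace ℝ U]
    [CompleteSpace U] (R : U →L[ℝ] U) : Prop :=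
  IsSelfAdjoint R ∧ ∀ u : U, u ≠ 0 → 0 < ⟪R u, u⟫_ℝ

/-- The inverse `R⁻¹ : ran R → U` of an injective bounded operator `R` on `U`. Its domain is all
of `U` when `R` is invertible. -/
def inverseOp {U : Type*} [NormedAddCommGroup U] [NormedSpace ℝ U]
    (R : U →L[ℝ] U) : U →ₗ.[ℝ] U :=
  ((R : U →ₗ[ℝ] U).toPMap ⊤).inverse

/-- The space `L²(0,τ;U)`. -/
abbrev L2 (τ : ℝ) (U : Type*) [NormedAddCommGroup U] : Type _ :=
  Lp U 2 ((volume : Measure ℝ).restrict (Ioc 0 τ))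

/-- The admissible inputs: the closed ball of radius `ρ` in `L²(0,τ;U)`. -/
def admissibleInputs (τ ρ : ℝ) (U : Type*) [NormedAddCommGroup U] : Set (L2 τ U) :=
  {u | ‖u‖ ≤ ρ}

/-- `x ∈ C([0,τ];X)` is the mild solution of `x' = A x + F(x) + B u`, `x(0) = x₀`, where `T` is the
semigroup generated by `A`. -/
def IsMildSolution {X U : Type*} [NormedAddCommGroup X] [NormedSpace ℝ X]
    [NormedAddCommGroup U] [NormedSpace ℝ U]
    (T : ℝ → X →L[ℝ] X) (F : X → X) (B : U →L[ℝ] X) (τ : ℝ) (x₀ : X) (u : L2 τ U)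
    (x : ℝ → X) : Prop :=
  ContinuousOn x (Icc 0 τ) ∧
  ∀ t ∈ Icc 0 τ,
    IntervalIntegrable (fun s => T (t - s) (F (x s))) volume 0 t ∧
    IntervalIntegrable (fun s => T (t - s) (B (u s))) volume 0 t ∧
    x t = T t x₀ + (∫ s in (0 : ℝ)..t, T (t - s) (F (x s)))
      + ∫ s in (0 : ℝ)..t, T (t - s) (B (u s))

/-- `p ∈ C([0,τ];X)` is the mild solution of the final value problem
`p' = -(A* + F'(x(t))*) p - Q x`, `p(τ) = 0`. Here `A` generates `T`, so that `A*` generates the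
adjoint semigroup `t ↦ T(t)*`. -/
def IsAdjointMildSolution {X : Type*} [NormedAddCommGroup X] [InnerProductSpace ℝ X]
    [CompleteSpace X]
    (T : ℝ → X →L[ℝ] X) (F' : X → X →L[ℝ] X) (Q : X →L[ℝ] X) (τ : ℝ) (x p : ℝ → X) : Prop :=
  ContinuousOn p (Icc 0 τ) ∧
  ∀ t ∈ Icc 0 τ,
    IntervalIntegrable (fun s => ((T (s - t))†) (((F' (x s))†) (p s) + Q (x s))) volume t τ ∧
    p t = ∫ s in t..τ, ((T (s - t))†) (((F' (x s))†) (p s) + Q (x s))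

/-- The quadratic cost `∫₀^τ ⟨Q x, x⟩ + ⟨R u, u⟩ dt`. -/
def cost {X U : Type*} [NormedAddCommGroup X] [InnerProductSpace ℝ X]
    [NormedAddCommGroup U] [InnerProductSpace ℝ U]
    (Q : X →L[ℝ] X) (R : U →L[ℝ] U) (τ : ℝ) (x : ℝ → X) (u : L2 τ U) : ℝ :=
  ∫ t in (0 : ℝ)..τ, (⟪Q (x t), x t⟫_ℝ + ⟪R (u t), u t⟫_ℝ)

/-- `(uo, ro)`, with trajectory `xo`, is a local minimizer of the cost over all `u` in the set of
admissible inputs and all `r ∈ Kad`, subject to the state equation; "local" refers to the norm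
topology of `L²(0,τ;U) × K`. -/
def IsLocalMinimizer {X U K : Type*} [NormedAddCommGroup X] [InnerProductSpace ℝ X]
    [NormedAddCommGroup U] [InnerProductSpace ℝ U] [NormedAddCommGroup K]
    (T : ℝ → X →L[ℝ] X) (F : X → X) (B : K → U →L[ℝ] X) (Q : X →L[ℝ] X) (R : U →L[ℝ] U)
    (τ ρ : ℝ) (Kad : Set K) (x₀ : X) (uo : L2 τ U) (ro : K) (xo : ℝ → X) : Prop :=
  uo ∈ admissibleInputs τ ρ U ∧ ro ∈ Kad ∧ IsMildSolution T F (B ro) τ x₀ uo xo ∧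
  ∀ᶠ q : L2 τ U × K in 𝓝 (uo, ro),
    q.1 ∈ admissibleInputs τ ρ U → q.2 ∈ Kad →
      ∀ x : ℝ → X, IsMildSolution T F (B q.2) τ x₀ q.1 x →
        cost Q R τ xo uo ≤ cost Q R τ x q.1

end

end ActuatorDesign

/-!
The proof is the adjoint calculus for a semilinear evolution equation, done without smoothness of the
nonlinearity beyond a Gateaux derivative bounded on bounded sets.

Perturb the minimizer along the line `(uo + e v, ro + e h)`, which stays admissible for small `e`
because the minimizer is interior. The bounded derivative makes `F` Lipschitz on balls, so after
truncating `F` outside a ball around the trajectory the state equation has a global mild solution for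
every `e`. Linearizing `F` only along the limiting direction `z`, dominated convergence and Grönwall's
inequality give `x_e = xo + e z + o(e)` uniformly on `[0, τ]`, where `z` is the mild solution of the
linearized equation with forcing `B(ro) v + (B'(ro) h) uo` (`exists_variation`). In particular `x_e`
stays near `xo`, where the truncation does nothing, so it is a genuine competitor in the minimization.

Hence the derivative of the cost, `2 ∫ ⟪Q xo, z⟫ + 2 ∫ ⟪R uo, v⟫`, vanishes. Fubini's theorem on the
triangle `s ≤ t` shows that forward and backward mild integrals are adjoint to each other, which turns
`∫ ⟪Q xo, z⟫` into `∫ ⟪p, B(ro) v + (B'(ro) h) uo⟫` (`integral_inner_linearized_eq`). The integrand of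
the adjoint equation is a priori only weakly measurable; separability of the state space makes it
measurable (`measurable_of_inner`).

The resulting identity (`variational_identity`) with `h = 0` says that `B(ro)* p + R uo` is orthogonal
to all of `L²`, so it vanishes almost everywhere and `B(ro)* p = R (-uo)` lies in the range of the
injective operator `R`; with `v = 0` it is the second condition, tested against `h`. -/

namespace ActuatorDesign

/-! ### Weak measurability -/

/-- Pettis' theorem in a separable Hilbert space: a weakly measurable function is measurable. The
map `x ↦ (⟪x, dₙ⟫)ₙ`, with `d` a dense sequence, is a continuous injection from a Polish space, hence
a measurable embedding (Lusin–Souslin). -/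
theorem measurable_of_inner {X Ω : Type*} [NormedAddCommGroup X] [InnerProductSpace ℝ X]
    [CompleteSpace X] [TopologicalSpace.SeparableSpace X] [MeasurableSpace X] [BorelSpace X]
    [MeasurableSpace Ω] {f : Ω → X} (hf : ∀ y : X, Measurable fun s => ⟪f s, y⟫_ℝ) :
    Measurable f := by
  have : SecondCountableTopology X := UniformSpace.secondCountable_of_separable X
  have hc : Continuous fun (x : X) (n : ℕ) => ⟪x, TopologicalSpace.denseSeq X n⟫_ℝ := by fun_prop
  have hi : Function.Injective fun (x : X) (n : ℕ) => ⟪x, TopologicalSpace.denseSeq X n⟫_ℝ := by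
    intro x y hxy
    refine ext_inner_right ℝ fun v => ?_
    have h : (fun v => ⟪x, v⟫_ℝ) = fun v => ⟪y, v⟫_ℝ :=
      DenseRange.equalizer (TopologicalSpace.denseRange_denseSeq X) (by fun_prop) (by fun_prop) hxy
    exact congrFun h v
  refine ((hc.measurableEmbedding hi).measurable_comp_iff).1 ?_
  exact measurable_pi_lambda _ fun n => hf _

/-! ### Strongly continuous bounded families and their convolutions -/

section Family

variable {X : Type*} [NormedAddCommGroup X] [NormedSpace ℝ X]

theorem exists_bound_of_strongly_continuous [CompleteSpace X] {T : ℝ → X →L[ℝ] X} {τ : ℝ}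
    (hT : ∀ x : X, ContinuousOn (fun t => T t x) (Icc 0 τ)) :
    ∃ M : ℝ, 0 ≤ M ∧ ∀ t ∈ Icc 0 τ, ‖T t‖ ≤ M := by
  obtain ⟨C, hC⟩ := banach_steinhaus (g := fun t : Icc (0 : ℝ) τ => T t) (by
    intro x
    obtain ⟨C, hC⟩ := isCompact_Icc.exists_bound_of_continuousOn (hT x)
    exact ⟨C, fun t => hC t t.2⟩)
  exact ⟨max C 0, le_max_right _ _, fun t ht => (hC ⟨t, ht⟩).trans (le_max_left _ _)⟩

/-- A strongly continuous family of operators on `ℝ`, uniformly bounded by `M`. -/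
structure IsBoundedFamily (S : ℝ → X →L[ℝ] X) (M : ℝ) : Prop where
  nonneg : 0 ≤ M
  bound : ∀ t, ‖S t‖ ≤ M
  cont : ∀ x, Continuous fun t => S t x

variable {S : ℝ → X →L[ℝ] X} {M τ : ℝ}

theorem IsBoundedFamily.norm_apply_le (hS : IsBoundedFamily S M) (t : ℝ) (x : X) :
    ‖S t x‖ ≤ M * ‖x‖ := (S t).le_of_opNorm_le (hS.bound t) x

theorem IsBoundedFamily.continuous_uncurry (hS : IsBoundedFamily S M) :
    Continuous fun q : ℝ × X => S q.1 q.2 := by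
  rw [continuous_iff_continuousAt]
  rintro ⟨t, x⟩
  have h1 : Tendsto (fun q : ℝ × X => M * ‖q.2 - x‖ + ‖S q.1 x - S t x‖) (𝓝 (t, x)) (𝓝 0) := by
    have : Continuous fun q : ℝ × X => M * ‖q.2 - x‖ + ‖S q.1 x - S t x‖ := by
      have h : Continuous fun q : ℝ × X => S q.1 x := (hS.cont x).comp continuous_fst
      exact (continuous_const.mul (continuous_snd.sub continuous_const).norm).add
        (h.sub continuous_const).norm
    simpa using this.tendsto (t, x)
  refine tendsto_iff_norm_sub_tendsto_zero.2
    (squeeze_zero (fun _ => norm_nonneg _) (fun q => ?_) h1)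
  calc ‖S q.1 q.2 - S t x‖ = ‖S q.1 (q.2 - x) + (S q.1 x - S t x)‖ := by
        rw [map_sub]; congr 1; abel
    _ ≤ _ := (norm_add_le _ _).trans (by gcongr; exact hS.norm_apply_le _ _)

theorem IsBoundedFamily.intervalIntegrable (hS : IsBoundedFamily S M) {f : ℝ → X} {a b : ℝ}
    (hf : IntervalIntegrable f volume a b) (t : ℝ) :
    IntervalIntegrable (fun s => S (t - s) (f s)) volume a b := by
  rw [intervalIntegrable_iff] at hf ⊢
  refine Integrable.mono' (hf.norm.const_mul M) ?_ (ae_of_all _ fun s => hS.norm_apply_le _ _)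
  exact hS.continuous_uncurry.comp_aestronglyMeasurable
    (AEStronglyMeasurable.prodMk (by fun_prop) hf.1)

theorem intervalIntegrable_initial {E : Type*} [NormedAddCommGroup E] {f : ℝ → E}
    (hf : IntervalIntegrable f volume 0 τ) {t : ℝ} (ht : t ∈ Icc 0 τ) :
    IntervalIntegrable f volume 0 t :=
  hf.mono_set (by
    rw [uIcc_of_le ht.1, uIcc_of_le (ht.1.trans ht.2)]; exact Icc_subset_Icc_right ht.2)

/-- The mild integral `t ↦ ∫₀ᵗ S(t - s) f(s) ds`. -/
noncomputable def conv (S : ℝ → X →L[ℝ] X) (f : ℝ → X) (t : ℝ) : X :=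
  ∫ s in (0 : ℝ)..t, S (t - s) (f s)

theorem conv_congr {f g : ℝ → X} {t : ℝ} (ht : t ∈ Icc 0 τ)
    (h : ∀ s ∈ Icc 0 τ, f s = g s) : conv S f t = conv S g t := by
  refine intervalIntegral.integral_congr fun s hs => ?_
  rw [uIcc_of_le ht.1] at hs
  simp only [h s ⟨hs.1, hs.2.trans ht.2⟩]

theorem IsBoundedFamily.conv_add (hS : IsBoundedFamily S M) {f g : ℝ → X}
    (hf : IntervalIntegrable f volume 0 τ) (hg : IntervalIntegrable g volume 0 τ) {t : ℝ}
    (ht : t ∈ Icc 0 τ) : conv S (fun s => f s + g s) t = conv S f t + conv S g t := by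
  simp only [conv, map_add]
  exact intervalIntegral.integral_add
    (hS.intervalIntegrable (intervalIntegrable_initial hf ht) t)
    (hS.intervalIntegrable (intervalIntegrable_initial hg ht) t)

theorem IsBoundedFamily.conv_sub (hS : IsBoundedFamily S M) {f g : ℝ → X}
    (hf : IntervalIntegrable f volume 0 τ) (hg : IntervalIntegrable g volume 0 τ) {t : ℝ}
    (ht : t ∈ Icc 0 τ) : conv S (fun s => f s - g s) t = conv S f t - conv S g t := by
  simp only [conv, map_sub]
  exact intervalIntegral.integral_sub
    (hS.intervalIntegrable (intervalIntegrable_initial hf ht) t)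
    (hS.intervalIntegrable (intervalIntegrable_initial hg ht) t)

theorem conv_smul (c : ℝ) (f : ℝ → X) (t : ℝ) :
    conv S (fun s => c • f s) t = c • conv S f t := by
  simp only [conv, map_smul]
  exact intervalIntegral.integral_smul _ _

theorem IsBoundedFamily.norm_conv_le (hS : IsBoundedFamily S M) {f : ℝ → X} {φ : ℝ → ℝ} {t : ℝ}
    (ht : t ∈ Icc 0 τ) (hφ : IntervalIntegrable φ volume 0 τ)
    (h : ∀ s ∈ Icc 0 τ, ‖f s‖ ≤ φ s) :
    ‖conv S f t‖ ≤ M * ∫ s in (0 : ℝ)..t, φ s := by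
  rw [← intervalIntegral.integral_const_mul]
  refine intervalIntegral.norm_integral_le_of_norm_le ht.1 (ae_of_all _ fun s hs => ?_)
    ((intervalIntegrable_initial hφ ht).const_mul M)
  exact (hS.norm_apply_le _ _).trans
    (mul_le_mul_of_nonneg_left (h s ⟨hs.1.le, hs.2.trans ht.2⟩) hS.nonneg)

/-- The mild integral of a merely integrable forcing term is continuous in time. -/
theorem IsBoundedFamily.continuousOn_conv (hS : IsBoundedFamily S M) {f : ℝ → X}
    (hf : IntervalIntegrable f volume 0 τ) : ContinuousOn (conv S f) (Icc 0 τ) := by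
  intro t₀ ht₀
  have hτ : 0 ≤ τ := ht₀.1.trans ht₀.2
  have hf' := (intervalIntegrable_iff_integrableOn_Ioc_of_le hτ).1 hf
  have key : ∀ t ∈ Icc 0 τ, conv S f t =
      ∫ s in Ioc 0 τ, (Iic t).indicator (fun s => S (t - s) (f s)) s := by
    intro t ht
    rw [conv, intervalIntegral.integral_of_le ht.1, setIntegral_indicator measurableSet_Iic,
      Ioc_inter_Iic, min_eq_right ht.2]
  refine ContinuousWithinAt.congr ?_ key (key t₀ ht₀)
  have hmeas : ∀ t, AEStronglyMeasurable (fun s => S (t - s) (f s))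
      (volume.restrict (Ioc 0 τ)) := fun t =>
    hS.continuous_uncurry.comp_aestronglyMeasurable
      (AEStronglyMeasurable.prodMk (by fun_prop) hf'.1)
  refine continuousWithinAt_of_dominated (bound := fun s => M * ‖f s‖) ?_ ?_
    (hf'.norm.const_mul M) ?_
  · exact Eventually.of_forall fun t => (hmeas t).indicator measurableSet_Iic
  · exact Eventually.of_forall fun t => ae_of_all _ fun s =>
      (norm_indicator_le_norm_self _ _).trans (hS.norm_apply_le _ _)
  · -- The integrand is continuous in `t` at `t₀` for every `s ≠ t₀`.
    have hne : ∀ᵐ s ∂(volume.restrict (Ioc 0 τ)), s ≠ t₀ :=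
      ae_restrict_of_ae (Measure.ae_ne volume t₀)
    filter_upwards [hne] with s hs
    refine ContinuousAt.continuousWithinAt ?_
    have hcont : Continuous fun t => S (t - s) (f s) :=
      (hS.cont (f s)).comp (continuous_id.sub continuous_const)
    rcases lt_or_gt_of_ne hs with h | h
    · refine hcont.continuousAt.congr ?_
      filter_upwards [lt_mem_nhds h] with t ht
      rw [indicator_of_mem (show s ∈ Iic t from ht.le)]
    · refine (continuousAt_const (y := (0 : X))).congr ?_
      filter_upwards [gt_mem_nhds h] with t ht
      rw [indicator_of_notMem (show s ∉ Iic t from not_le.2 ht)]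

end Family

/-! ### Volterra integral equations -/

theorem integral_exp_mul_le {l t : ℝ} (hl : 0 < l) :
    ∫ s in (0 : ℝ)..t, Real.exp (l * s) ≤ l⁻¹ * Real.exp (l * t) := by
  rw [intervalIntegral.integral_comp_mul_left _ hl.ne', integral_exp, smul_eq_mul]
  have : 0 < l⁻¹ := inv_pos.2 hl
  have h2 := Real.exp_pos (l * 0)
  nlinarith

/-- Grönwall's inequality in integral form for continuous functions, with a constant that is not
sharp. -/
theorem le_of_le_add_integral {φ : ℝ → ℝ} {c k τ : ℝ} (hφ : ContinuousOn φ (Icc 0 τ))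
    (hk : 0 ≤ k) (hc : 0 ≤ c)
    (h : ∀ t ∈ Icc 0 τ, φ t ≤ c + k * ∫ s in (0 : ℝ)..t, φ s) :
    ∀ t ∈ Icc 0 τ, φ t ≤ 2 * Real.exp ((2 * k + 1) * τ) * c := by
  intro t ht
  set l := 2 * k + 1 with hl
  have hl0 : 0 < l := by positivity
  have hτ : 0 ≤ τ := ht.1.trans ht.2
  -- The maximum `m` of `exp (-l s) φ s` satisfies `m ≤ c + m / 2`.
  obtain ⟨b, hb, hmax⟩ := isCompact_Icc.exists_isMaxOn (nonempty_Icc.2 hτ)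
    (ContinuousOn.mul (f := fun s => Real.exp (-(l * s))) (by fun_prop) hφ)
  set m := Real.exp (-(l * b)) * φ b with hm
  have hle : ∀ s ∈ Icc 0 τ, φ s ≤ m * Real.exp (l * s) := by
    intro s hs
    have h1 : Real.exp (-(l * s)) * φ s ≤ m := hmax hs
    calc φ s = (Real.exp (-(l * s)) * φ s) * Real.exp (l * s) := by
          rw [mul_right_comm, ← Real.exp_add]; simp
      _ ≤ _ := by gcongr
  have hm2 : m ≤ 2 * c := by
    by_contra! hcon
    have hm0 : 0 < m := by linarith
    have hint : ∫ s in (0 : ℝ)..b, φ s ≤ m * (l⁻¹ * Real.exp (l * b)) := by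
      calc ∫ s in (0 : ℝ)..b, φ s ≤ ∫ s in (0 : ℝ)..b, m * Real.exp (l * s) := by
            refine intervalIntegral.integral_mono_on hb.1 ?_
              (Continuous.intervalIntegrable (by fun_prop) _ _)
              fun s hs => hle s ⟨hs.1, hs.2.trans hb.2⟩
            exact (hφ.mono (by
              rw [uIcc_of_le hb.1]; exact Icc_subset_Icc_right hb.2)).intervalIntegrable
        _ ≤ _ := by
            rw [intervalIntegral.integral_const_mul]
            gcongr
            exact integral_exp_mul_le hl0
    have hφb : φ b = m * Real.exp (l * b) := by
      rw [hm, mul_right_comm, ← Real.exp_add]; simp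
    have he : 1 ≤ Real.exp (l * b) := Real.one_le_exp (mul_nonneg hl0.le hb.1)
    have hkl : k * l⁻¹ ≤ 1 / 2 := by
      rw [← div_eq_mul_inv, div_le_iff₀ hl0]; linarith
    have h3 := h b hb
    have h4 : k * ∫ s in (0 : ℝ)..b, φ s ≤ 1 / 2 * (m * Real.exp (l * b)) :=
      calc k * ∫ s in (0 : ℝ)..b, φ s ≤ k * (m * (l⁻¹ * Real.exp (l * b))) := by gcongr
        _ = (k * l⁻¹) * (m * Real.exp (l * b)) := by ring
        _ ≤ _ := by gcongr
    rw [hφb] at h3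
    nlinarith
  calc φ t ≤ m * Real.exp (l * t) := hle t ht
    _ ≤ (2 * c) * Real.exp (l * τ) := by
        gcongr
        exact ht.2
    _ = _ := by ring

/-- Existence for the mild equation `x t = a t + ∫₀ᵗ S(t - s) G(s, x(s)) ds` with `G` globally
Lipschitz in the state. It is applied to the truncated nonlinear equation and to its linearization. -/
theorem exists_volterra_solution {X : Type*} [NormedAddCommGroup X] [NormedSpace ℝ X]
    [CompleteSpace X] {S : ℝ → X →L[ℝ] X} {M L τ : ℝ} (hS : IsBoundedFamily S M) (hτ : 0 ≤ τ)
    {G : ℝ → X → X} (hL : 0 ≤ L) (hG : ∀ s ∈ Icc 0 τ, ∀ x y, ‖G s x - G s y‖ ≤ L * ‖x - y‖)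
    (hGi : ∀ x : ℝ → X, Continuous x → IntervalIntegrable (fun s => G s (x s)) volume 0 τ)
    {a : ℝ → X} (ha : ContinuousOn a (Icc 0 τ)) :
    ∃ x : ℝ → X, Continuous x ∧ ∀ t ∈ Icc 0 τ, x t = a t + conv S (fun s => G s (x s)) t := by
  set l := 2 * (M * L) + 1 with hl
  have hM := hS.nonneg
  have hl0 : 0 < l := by positivity
  -- `y` encodes the candidate solution `x t = exp (l t) y t`; in the weighted variable the
  -- Picard map is a contraction on the whole interval.
  let ext : C(Icc (0 : ℝ) τ, X) → ℝ → X := fun y t => Real.exp (l * t) • y (projIcc 0 τ hτ t)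
  have hext : ∀ y, Continuous (ext y) := fun y =>
    Continuous.smul (by fun_prop) (y.continuous.comp continuous_projIcc)
  have hcont : ∀ y, ContinuousOn
      (fun t => Real.exp (-(l * t)) • (a t + conv S (fun s => G s (ext y s)) t)) (Icc 0 τ) :=
    fun y => ContinuousOn.smul (by fun_prop)
      (ha.add (hS.continuousOn_conv (hGi _ (hext y))))
  let Ψ : C(Icc (0 : ℝ) τ, X) → C(Icc (0 : ℝ) τ, X) := fun y =>
    ⟨_, continuousOn_iff_continuous_domRestrict.1 (hcont y)⟩
  have hΨ : ContractingWith (1 / 2) Ψ := by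
    refine ⟨by norm_num, LipschitzWith.of_dist_le_mul fun y₁ y₂ => ?_⟩
    rw [ContinuousMap.dist_le (by positivity)]
    rintro ⟨t, ht⟩
    have hd : ∀ s ∈ Icc 0 τ, ‖G s (ext y₁ s) - G s (ext y₂ s)‖
        ≤ L * dist y₁ y₂ * Real.exp (l * s) := by
      intro s hs
      refine (hG s hs _ _).trans ?_
      simp only [ext]
      rw [← smul_sub, norm_smul, Real.norm_of_nonneg (Real.exp_nonneg _), mul_assoc,
        mul_comm (dist _ _)]
      gcongr
      rw [← dist_eq_norm]
      exact ContinuousMap.dist_apply_le_dist _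
    have h1 := hS.norm_conv_le ht (Continuous.intervalIntegrable (by fun_prop) _ _) hd
    rw [hS.conv_sub (hGi _ (hext y₁)) (hGi _ (hext y₂)) ht,
      intervalIntegral.integral_const_mul] at h1
    have h2 : ‖conv S (fun s => G s (ext y₁ s)) t - conv S (fun s => G s (ext y₂ s)) t‖
        ≤ 1 / 2 * dist y₁ y₂ * Real.exp (l * t) := by
      refine h1.trans ?_
      have hkl : M * L * l⁻¹ ≤ 1 / 2 := by
        rw [← div_eq_mul_inv, div_le_iff₀ hl0]; linarith
      calc M * (L * dist y₁ y₂ * ∫ s in (0 : ℝ)..t, Real.exp (l * s))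
          ≤ M * (L * dist y₁ y₂ * (l⁻¹ * Real.exp (l * t))) := by
            gcongr; exact integral_exp_mul_le hl0
        _ = (M * L * l⁻¹) * (dist y₁ y₂ * Real.exp (l * t)) := by ring
        _ ≤ 1 / 2 * (dist y₁ y₂ * Real.exp (l * t)) := by gcongr
        _ = _ := by ring
    change dist (Real.exp (-(l * t)) • (a t + conv S (fun s => G s (ext y₁ s)) t))
      (Real.exp (-(l * t)) • (a t + conv S (fun s => G s (ext y₂ s)) t)) ≤ _
    rw [dist_eq_norm, ← smul_sub, add_sub_add_left_eq_sub, norm_smul,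
      Real.norm_of_nonneg (Real.exp_nonneg _)]
    calc _ ≤ Real.exp (-(l * t)) * (1 / 2 * dist y₁ y₂ * Real.exp (l * t)) := by gcongr
      _ = (1 / 2 * dist y₁ y₂) * (Real.exp (-(l * t)) * Real.exp (l * t)) := by ring
      _ = _ := by rw [← Real.exp_add]; simp
  have hfix : Ψ (hΨ.fixedPoint Ψ) = hΨ.fixedPoint Ψ := hΨ.fixedPoint_isFixedPt
  set y := hΨ.fixedPoint Ψ
  refine ⟨ext y, hext y, fun t ht => ?_⟩
  have h1 : y ⟨t, ht⟩ = Real.exp (-(l * t)) • (a t + conv S (fun s => G s (ext y s)) t) := by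
    conv_lhs => rw [← hfix]
    rfl
  change Real.exp (l * t) • y (projIcc 0 τ hτ t) = _
  rw [projIcc_of_mem hτ ht, h1, smul_smul, ← Real.exp_add]
  simp

/-! ### Gateaux derivatives that are bounded on bounded sets -/

section Gateaux

variable {X : Type*} [NormedAddCommGroup X] [NormedSpace ℝ X] {F : X → X} {F' : X → X →L[ℝ] X}

/-- A map whose Gateaux derivative is bounded on bounded sets is Lipschitz on balls, by the mean
value inequality on segments. -/
theorem exists_lipschitz_closedBall (hF : HasGateauxDeriv F F') (hF' : MapsBoundedOn F' univ)
    (r : ℝ) : ∃ L : ℝ, 0 ≤ L ∧ (∀ x, ‖x‖ ≤ r → ‖F' x‖ ≤ L) ∧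
      ∀ x y, ‖x‖ ≤ r → ‖y‖ ≤ r → ‖F x - F y‖ ≤ L * ‖x - y‖ := by
  obtain ⟨C, hC⟩ := (hF' (Metric.closedBall 0 r) (subset_univ _)
    Metric.isBounded_closedBall).exists_norm_le
  have hb : ∀ x, ‖x‖ ≤ r → ‖F' x‖ ≤ max C 0 := fun x hx =>
    (hC _ (mem_image_of_mem _ (by simpa using hx))).trans (le_max_left _ _)
  refine ⟨max C 0, le_max_right _ _, hb, fun x y hx hy => ?_⟩
  have hd : ∀ t ∈ Icc (0 : ℝ) 1, HasDerivWithinAt (fun t : ℝ => F (y + t • (x - y)))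
      (F' (y + t • (x - y)) (x - y)) (Icc 0 1) t := by
    intro t _
    have h1 : HasDerivAt (fun u : ℝ => F (y + t • (x - y) + u • (x - y)))
      (F' (y + t • (x - y)) (x - y)) (t - t) := by
      rw [sub_self]; exact hF (y + t • (x - y)) (x - y)
    have h2 := h1.comp_sub_const t t
    refine (h2.congr_of_eventuallyEq (Eventually.of_forall fun u => ?_)).hasDerivWithinAt
    change F (y + u • (x - y)) = F (y + t • (x - y) + (u - t) • (x - y))
    congr 1
    module
  have h := norm_image_sub_le_of_norm_deriv_le_segment_01' hd (C := max C 0 * ‖x - y‖) (by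
    intro t ht
    refine (F' _).le_of_opNorm_le (hb _ ?_) _
    have hmem : y + t • (x - y) ∈ Metric.closedBall (0 : X) r :=
      (convex_closedBall 0 r).add_smul_sub_mem (by simpa using hy) (by simpa using hx)
        ⟨ht.1, ht.2.le⟩
    simpa using hmem)
  simpa using h

theorem HasGateauxDeriv.continuous (hF : HasGateauxDeriv F F') (hF' : MapsBoundedOn F' univ) :
    Continuous F := by
  rw [continuous_iff_continuousAt]
  intro x
  obtain ⟨L, hL, -, h⟩ := exists_lipschitz_closedBall hF hF' (‖x‖ + 1)
  have h1 : Tendsto (fun y => L * ‖y - x‖) (𝓝 x) (𝓝 0) := by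
    have : Continuous fun y => L * ‖y - x‖ := by fun_prop
    simpa using this.tendsto x
  refine tendsto_iff_norm_sub_tendsto_zero.2
    (squeeze_zero' (Eventually.of_forall fun _ => norm_nonneg _) ?_ h1)
  filter_upwards [Metric.ball_mem_nhds x one_pos] with y hy
  refine h y x ?_ (by linarith)
  have h2 : ‖y - x‖ < 1 := by rwa [← dist_eq_norm]
  linarith [norm_le_norm_add_norm_sub x y, norm_sub_rev x y]

theorem HasGateauxDeriv.tendsto_slope (hF : HasGateauxDeriv F F') (x v : X) :
    Tendsto (fun e : ℝ => e⁻¹ • (F (x + e • v) - F x)) (𝓝[≠] 0) (𝓝 (F' x v)) := by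
  have h := hasDerivAt_iff_tendsto_slope_zero.1 (hF x v)
  simpa using h

/-- No continuity of `x ↦ F' x` is assumed; measurability comes from the difference quotients, which
are continuous in `s`. -/
theorem HasGateauxDeriv.stronglyMeasurable (hF : HasGateauxDeriv F F')
    (hF' : MapsBoundedOn F' univ) {x v : ℝ → X} (hx : Continuous x) (hv : Continuous v) :
    StronglyMeasurable fun s => F' (x s) (v s) := by
  have hFc := hF.continuous hF'
  refine stronglyMeasurable_of_tendsto (u := 𝓝[≠] (0 : ℝ))
    (f := fun e s => e⁻¹ • (F (x s + e • v s) - F (x s))) (fun e => ?_)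
    (tendsto_pi_nhds.2 fun s => hF.tendsto_slope _ _)
  exact Continuous.stronglyMeasurable (by fun_prop)

/-- The radial retraction onto the closed ball of radius `r > 0`. -/
noncomputable def radialRetract (r : ℝ) (x : X) : X := (r / max r ‖x‖) • x

theorem radialRetract_of_le {r : ℝ} (hr : 0 < r) {x : X} (hx : ‖x‖ ≤ r) :
    radialRetract r x = x := by
  rw [radialRetract, max_eq_left hx, div_self hr.ne', one_smul]

theorem norm_radialRetract_le {r : ℝ} (hr : 0 < r) (x : X) : ‖radialRetract r x‖ ≤ r := by
  have hm : 0 < max r ‖x‖ := lt_max_of_lt_left hr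
  rw [radialRetract, norm_smul, Real.norm_of_nonneg (by positivity), div_mul_eq_mul_div,
    div_le_iff₀ hm]
  gcongr
  exact le_max_right _ _

theorem norm_radialRetract_sub_le {r : ℝ} (hr : 0 < r) (x y : X) :
    ‖radialRetract r x - radialRetract r y‖ ≤ 2 * ‖x - y‖ := by
  have hx : 0 < max r ‖x‖ := lt_max_of_lt_left hr
  have hy : 0 < max r ‖y‖ := lt_max_of_lt_left hr
  have h1 : |max r ‖y‖ - max r ‖x‖| ≤ ‖x - y‖ := by
    refine (abs_max_sub_max_le_max _ _ _ _).trans ?_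
    rw [sub_self, abs_zero, max_eq_right (abs_nonneg _), norm_sub_rev]
    exact abs_norm_sub_norm_le y x
  have h2 : |r / max r ‖x‖ - r / max r ‖y‖| * ‖y‖ ≤ ‖x - y‖ := by
    have he : r / max r ‖x‖ - r / max r ‖y‖
        = (r / max r ‖x‖) * ((max r ‖y‖ - max r ‖x‖) / max r ‖y‖) := by
      field_simp
    rw [he, abs_mul, abs_of_pos (by positivity : 0 < r / max r ‖x‖), abs_div, abs_of_pos hy]
    have ha : r / max r ‖x‖ ≤ 1 := (div_le_one hx).2 (le_max_left _ _)
    calc _ ≤ 1 * (‖x - y‖ / max r ‖y‖) * max r ‖y‖ := by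
          gcongr
          exact le_max_right _ _
      _ = _ := by field_simp
  calc ‖radialRetract r x - radialRetract r y‖
      = ‖(r / max r ‖x‖) • (x - y) + (r / max r ‖x‖ - r / max r ‖y‖) • y‖ := by
        congr 1; simp only [radialRetract]; module
    _ ≤ 1 * ‖x - y‖ + ‖x - y‖ := by
        refine (norm_add_le _ _).trans ?_
        rw [norm_smul, norm_smul, Real.norm_of_nonneg (by positivity), Real.norm_eq_abs]
        gcongr
        exact (div_le_one hx).2 (le_max_left _ _)
    _ = _ := by ring

end Gateaux

/-! ### Differentiability of mild solutions with respect to the forcing term -/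

/-- If the forcing term `β e` has derivative `γ` at `e = 0` in `L¹`, then for small `e` the perturbed
equation has a mild solution on all of `[0, τ]`, and the solution is differentiable in `e`, uniformly
in time, with derivative the mild solution `z` of the linearized equation.

Gateaux differentiability of `F` suffices: by the Lipschitz bound it is enough to linearize `F` along
the fixed directions `z s`, pointwise in `s`, and dominated convergence makes the error small in
`L¹`. -/
theorem exists_variation {X : Type*} [NormedAddCommGroup X] [NormedSpace ℝ X] [CompleteSpace X]
    {F : X → X} {F' : X → X →L[ℝ] X} (hF : HasGateauxDeriv F F') (hF' : MapsBoundedOn F' univ)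
    {S : ℝ → X →L[ℝ] X} {M τ : ℝ} (hS : IsBoundedFamily S M) (hτ : 0 ≤ τ)
    {a : ℝ → X} (ha : ContinuousOn a (Icc 0 τ)) {xo : ℝ → X} (hxo : Continuous xo)
    {β : ℝ → ℝ → X} {γ : ℝ → X} (hβ : ∀ e, IntervalIntegrable (β e) volume 0 τ)
    (hγ : IntervalIntegrable γ volume 0 τ)
    (hxo_eq : ∀ t ∈ Icc 0 τ,
      xo t = a t + conv S (fun s => F (xo s)) t + conv S (β 0) t)
    {δ : ℝ → ℝ} (hδ : Tendsto δ (𝓝[≠] 0) (𝓝 0))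
    (hδβ : ∀ᶠ e in 𝓝[≠] (0 : ℝ),
      ∫ s in (0 : ℝ)..τ, ‖β e s - β 0 s - e • γ s‖ ≤ |e| * δ e) :
    ∃ (z : ℝ → X) (x : ℝ → ℝ → X) (η : ℝ → ℝ), Continuous z ∧ (∀ e, Continuous (x e)) ∧
      IntervalIntegrable (fun s => F' (xo s) (z s)) volume 0 τ ∧
      (∀ t ∈ Icc 0 τ, z t = conv S (fun s => F' (xo s) (z s) + γ s) t) ∧
      Tendsto η (𝓝[≠] 0) (𝓝 0) ∧
      ∀ᶠ e in 𝓝[≠] (0 : ℝ),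
        (∀ t ∈ Icc 0 τ, x e t = a t + conv S (fun s => F (x e s)) t + conv S (β e) t) ∧
        ∀ t ∈ Icc 0 τ, ‖x e t - xo t - e • z t‖ ≤ |e| * η e := by
  have hFc := hF.continuous hF'
  have hM := hS.nonneg
  obtain ⟨r₀, hr₀⟩ := isCompact_Icc.exists_bound_of_continuousOn
    (hxo.continuousOn (s := Icc 0 τ))
  set r := max r₀ 0 + 1 with hrdef
  have hr : 0 < r := by positivity
  have hxr : ∀ s ∈ Icc 0 τ, ‖xo s‖ ≤ r - 1 := fun s hs =>
    (hr₀ s hs).trans (by rw [hrdef]; linarith [le_max_left r₀ 0])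
  obtain ⟨L, hL, hLb, hLip⟩ := exists_lipschitz_closedBall hF hF' r
  -- `f` is globally Lipschitz and agrees with `F` near the trajectory of `xo`.
  set f : X → X := fun x => F (radialRetract r x) with hf
  have hfF : ∀ x, ‖x‖ ≤ r → f x = F x := fun x hx => by
    simp only [hf, radialRetract_of_le hr hx]
  have hfLip : ∀ x y, ‖f x - f y‖ ≤ 2 * L * ‖x - y‖ := fun x y =>
    calc ‖f x - f y‖ ≤ L * ‖radialRetract r x - radialRetract r y‖ :=
          hLip _ _ (norm_radialRetract_le hr x) (norm_radialRetract_le hr y)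
      _ ≤ L * (2 * ‖x - y‖) := by gcongr; exact norm_radialRetract_sub_le hr x y
      _ = _ := by ring
  have hfc : Continuous f := by
    refine (LipschitzWith.of_dist_le_mul (K := (2 * L).toNNReal) fun x y => ?_).continuous
    rw [dist_eq_norm, dist_eq_norm, Real.coe_toNNReal _ (by positivity)]
    exact hfLip x y
  have hF'b : ∀ s ∈ Icc 0 τ, ‖F' (xo s)‖ ≤ L := fun s hs =>
    hLb _ ((hxr s hs).trans (by linarith))
  have hF'i : ∀ v : ℝ → X, Continuous v →
      IntervalIntegrable (fun s => F' (xo s) (v s)) volume 0 τ := by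
    intro v hv
    refine IntervalIntegrable.mono_fun' (g := fun s => L * ‖v s‖)
      (Continuous.intervalIntegrable (by fun_prop) _ _)
      (hF.stronglyMeasurable hF' hxo hv).aestronglyMeasurable ?_
    rw [uIoc_of_le hτ]
    filter_upwards [ae_restrict_mem measurableSet_Ioc] with s hs
    exact (F' (xo s)).le_of_opNorm_le (hF'b s (Ioc_subset_Icc_self hs)) _
  obtain ⟨z, hz, hzeq⟩ := exists_volterra_solution hS hτ (G := fun s x => F' (xo s) x) hL
    (fun s hs x y => by
      rw [← map_sub]; exact (F' (xo s)).le_of_opNorm_le (hF'b s hs) _) hF'i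
    (hS.continuousOn_conv hγ)
  have hx : ∀ e, ∃ x : ℝ → X, Continuous x ∧ ∀ t ∈ Icc 0 τ,
      x t = (a t + conv S (β e) t) + conv S (fun s => f (x s)) t := fun e =>
    exists_volterra_solution hS hτ (G := fun _ x => f x) (L := 2 * L) (by positivity)
      (fun s _ x y => hfLip x y)
      (fun x hx => Continuous.intervalIntegrable (by fun_prop) _ _)
      (ha.add (hS.continuousOn_conv (hβ e)))
  choose x hxc hxeq using hx
  -- `d e` is the error of linearizing `f` at `xo` in the direction `z`, divided by `e`.
  set d : ℝ → ℝ → ℝ := fun e s => ‖e⁻¹ • (f (xo s + e • z s) - f (xo s)) - F' (xo s) (z s)‖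
    with hd
  have hdi : ∀ e, IntervalIntegrable (d e) volume 0 τ := fun e => by
    have hc : Continuous fun s => e⁻¹ • (f (xo s + e • z s) - f (xo s)) := by fun_prop
    exact ((hc.intervalIntegrable (μ := volume) 0 τ).sub (hF'i z hz)).norm
  have hdlim : Tendsto (fun e => ∫ s in (0 : ℝ)..τ, d e s) (𝓝[≠] 0) (𝓝 0) := by
    suffices h : Tendsto (fun e => ∫ s in (0 : ℝ)..τ, d e s) (𝓝[≠] 0)
        (𝓝 (∫ s in (0 : ℝ)..τ, (0 : ℝ))) by simpa using h
    refine intervalIntegral.tendsto_integral_filter_of_dominated_convergence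
      (fun s => 3 * L * ‖z s‖) ?_ ?_
      (Continuous.intervalIntegrable (by fun_prop) _ _) ?_
    · exact Eventually.of_forall fun e => (hdi e).aestronglyMeasurable_restrict_uIoc
    · filter_upwards [self_mem_nhdsWithin] with e he
      refine ae_of_all _ fun s hs => ?_
      rw [uIoc_of_le hτ] at hs
      rw [norm_norm]
      refine (norm_sub_le _ _).trans ?_
      have h1 : ‖e⁻¹ • (f (xo s + e • z s) - f (xo s))‖ ≤ 2 * L * ‖z s‖ := by
        have h2 := hfLip (xo s + e • z s) (xo s)
        rw [add_sub_cancel_left, norm_smul] at h2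
        have he' : 0 < ‖e‖ := norm_pos_iff.2 he
        rw [norm_smul, norm_inv, inv_mul_le_iff₀ he']
        linarith
      have h3 := (F' (xo s)).le_of_opNorm_le (hF'b s (Ioc_subset_Icc_self hs)) (z s)
      linarith
    · refine ae_of_all _ fun s hs => ?_
      rw [uIoc_of_le hτ] at hs
      have hxs := hxr s (Ioc_subset_Icc_self hs)
      have h1 : Tendsto (fun e : ℝ => e⁻¹ • (f (xo s + e • z s) - f (xo s))) (𝓝[≠] 0)
          (𝓝 (F' (xo s) (z s))) := by
        refine (hF.tendsto_slope (xo s) (z s)).congr' ?_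
        have hc : Continuous fun e : ℝ => ‖xo s + e • z s‖ := by fun_prop
        have hev : ∀ᶠ e : ℝ in 𝓝 0, ‖xo s + e • z s‖ < r :=
          hc.tendsto 0 (Iio_mem_nhds (by simp; linarith))
        filter_upwards [hev.filter_mono nhdsWithin_le_nhds] with e he
        rw [hfF _ he.le, hfF _ (hxs.trans (by linarith))]
      simpa using (h1.sub_const (F' (xo s) (z s))).norm
  set C := 2 * Real.exp ((2 * (M * (2 * L)) + 1) * τ) with hC
  set η : ℝ → ℝ := fun e => C * (M * ((∫ s in (0 : ℝ)..τ, d e s) + δ e)) with hη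
  have hηlim : Tendsto η (𝓝[≠] 0) (𝓝 0) := by
    simpa using ((hdlim.add hδ).const_mul M).const_mul C
  have hest : ∀ᶠ e in 𝓝[≠] (0 : ℝ), ∀ t ∈ Icc 0 τ, ‖x e t - xo t - e • z t‖ ≤ |e| * η e := by
    filter_upwards [hδβ, self_mem_nhdsWithin] with e hβe he
    have he0 : e ≠ 0 := he
    set w : ℝ → X := fun t => x e t - xo t - e • z t with hw
    have hxec := hxc e
    have hwc : Continuous w := by fun_prop
    set ψ : ℝ → ℝ := fun s => ‖β e s - β 0 s - e • γ s‖ with hψ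
    have hψi : IntervalIntegrable ψ volume 0 τ := (((hβ e).sub (hβ 0)).sub (hγ.smul e)).norm
    have hi1 : IntervalIntegrable (fun s => f (x e s)) volume 0 τ :=
      Continuous.intervalIntegrable (by fun_prop) _ _
    have hi2 : IntervalIntegrable (fun s => f (xo s)) volume 0 τ :=
      Continuous.intervalIntegrable (by fun_prop) _ _
    have hi3 : IntervalIntegrable (fun s => e • F' (xo s) (z s)) volume 0 τ := (hF'i z hz).smul e
    have hi4 : IntervalIntegrable (fun s => e • γ s) volume 0 τ := hγ.smul e
    have hweq : ∀ t ∈ Icc 0 τ, w t = conv S (fun s =>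
        ((f (x e s) - f (xo s)) - e • F' (xo s) (z s)) + ((β e s - β 0 s) - e • γ s)) t := by
      intro t ht
      rw [hS.conv_add ((hi1.sub hi2).sub hi3) (((hβ e).sub (hβ 0)).sub hi4) ht,
        hS.conv_sub (hi1.sub hi2) hi3 ht, hS.conv_sub hi1 hi2 ht,
        hS.conv_sub ((hβ e).sub (hβ 0)) hi4 ht, hS.conv_sub (hβ e) (hβ 0) ht,
        conv_smul, conv_smul]
      have hxo' : conv S (fun s => F (xo s)) t = conv S (fun s => f (xo s)) t :=
        conv_congr ht fun s hs => (hfF _ ((hxr s hs).trans (by linarith))).symm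
      simp only [hw]
      rw [hxeq e t ht, hxo_eq t ht, hzeq t ht, hxo']
      module
    have hbound : ∀ s ∈ Icc 0 τ,
        ‖((f (x e s) - f (xo s)) - e • F' (xo s) (z s)) + ((β e s - β 0 s) - e • γ s)‖
          ≤ (2 * L * ‖w s‖ + |e| * d e s) + ψ s := by
      intro s _
      refine (norm_add_le _ _).trans (add_le_add_left ?_ _)
      -- Through `xo + e z`: the first difference is Lipschitz in `w`, the second is `e` times `d e`.
      have h1 : (f (x e s) - f (xo s)) - e • F' (xo s) (z s)
          = (f (x e s) - f (xo s + e • z s))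
            + e • (e⁻¹ • (f (xo s + e • z s) - f (xo s)) - F' (xo s) (z s)) := by
        rw [smul_sub, smul_smul, mul_inv_cancel₀ he0]
        module
      rw [h1]
      refine (norm_add_le _ _).trans (add_le_add ?_ ?_)
      · refine (hfLip _ _).trans_eq ?_
        simp only [hw, sub_sub]
      · rw [norm_smul, Real.norm_eq_abs]
    have hwn : ∀ t ∈ Icc 0 τ, ‖w t‖ ≤ |e| * (M * ((∫ s in (0 : ℝ)..τ, d e s) + δ e))
        + M * (2 * L) * ∫ s in (0 : ℝ)..t, ‖w s‖ := by
      intro t ht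
      have hwi : IntervalIntegrable (fun s => 2 * L * ‖w s‖) volume 0 τ :=
        Continuous.intervalIntegrable (by fun_prop) _ _
      have h1 := hS.norm_conv_le ht ((hwi.add ((hdi e).const_mul |e|)).add hψi) hbound
      rw [← hweq t ht, intervalIntegral.integral_add
        (intervalIntegrable_initial (hwi.add ((hdi e).const_mul |e|)) ht)
        (intervalIntegrable_initial hψi ht), intervalIntegral.integral_add
        (intervalIntegrable_initial hwi ht)
        (intervalIntegrable_initial ((hdi e).const_mul |e|) ht),
        intervalIntegral.integral_const_mul, intervalIntegral.integral_const_mul] at h1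
      have hmono : ∀ φ : ℝ → ℝ, IntervalIntegrable φ volume 0 τ → (∀ s, 0 ≤ φ s) →
          ∫ s in (0 : ℝ)..t, φ s ≤ ∫ s in (0 : ℝ)..τ, φ s := fun φ hφ hφ0 =>
        intervalIntegral.integral_mono_interval le_rfl ht.1 ht.2 (ae_of_all _ hφ0) hφ
      have h2 := hmono (d e) (hdi e) fun s => norm_nonneg _
      have h3 := (hmono ψ hψi fun s => norm_nonneg _).trans hβe
      refine h1.trans ?_
      calc M * (2 * L * (∫ s in (0 : ℝ)..t, ‖w s‖) + |e| * (∫ s in (0 : ℝ)..t, d e s)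
            + ∫ s in (0 : ℝ)..t, ψ s)
          ≤ M * (2 * L * (∫ s in (0 : ℝ)..t, ‖w s‖) + |e| * (∫ s in (0 : ℝ)..τ, d e s)
            + |e| * δ e) := by gcongr
        _ = _ := by ring
    have hc0 : 0 ≤ |e| * (M * ((∫ s in (0 : ℝ)..τ, d e s) + δ e)) := by
      have h1 : 0 ≤ ∫ s in (0 : ℝ)..τ, d e s :=
        intervalIntegral.integral_nonneg hτ fun s _ => norm_nonneg _
      have h2 : 0 ≤ |e| * δ e :=
        (intervalIntegral.integral_nonneg hτ fun s _ => norm_nonneg _).trans hβe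
      have h3 : 0 ≤ δ e := nonneg_of_mul_nonneg_right h2 (abs_pos.2 he0)
      positivity
    intro t ht
    refine (le_of_le_add_integral (φ := fun t => ‖w t‖) (by fun_prop) (by positivity) hc0
      hwn t ht).trans_eq ?_
    simp only [hη, hC]
    ring
  refine ⟨z, x, η, hz, hxc, hF'i z hz, fun t ht => ?_, hηlim, ?_⟩
  · rw [hS.conv_add (hF'i z hz) hγ ht, add_comm]
    exact hzeq t ht
  · obtain ⟨Z, hZ⟩ := isCompact_Icc.exists_bound_of_continuousOn
      (hz.continuousOn (s := Icc 0 τ))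
    have hsmall : Tendsto (fun e : ℝ => |e| * (Z + η e)) (𝓝[≠] 0) (𝓝 0) := by
      have h1 : Tendsto (fun e : ℝ => |e|) (𝓝[≠] 0) (𝓝 0) := by
        have := (continuous_abs (G := ℝ)).tendsto 0
        rw [abs_zero] at this
        exact this.mono_left nhdsWithin_le_nhds
      simpa using h1.mul (hηlim.const_add Z)
    filter_upwards [hest, hsmall.eventually (gt_mem_nhds one_pos)] with e he h1
    refine ⟨fun t ht => ?_, he⟩
    -- For small `e` the trajectory stays in the ball on which the truncation is inactive.
    have hball : ∀ s ∈ Icc 0 τ, ‖x e s‖ ≤ r := by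
      intro s hs
      have h2 : x e s = xo s + e • z s + (x e s - xo s - e • z s) := by abel
      have h3 : ‖e • z s‖ ≤ |e| * Z := by
        rw [norm_smul, Real.norm_eq_abs]; gcongr; exact hZ s hs
      rw [h2]
      refine (norm_add₃_le).trans ?_
      linarith [hxr s hs, he s hs]
    rw [conv_congr (g := fun s => f (x e s)) ht fun s hs => (hfF _ (hball s hs)).symm,
      hxeq e t ht]
    abel

/-! ### Duality between the linearized state and the adjoint state -/

section Duality

variable {X : Type*} [NormedAddCommGroup X] [InnerProductSpace ℝ X]

theorem intervalIntegrable_inner {p f : ℝ → X} {τ : ℝ} (hp : Continuous p)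
    (hf : IntervalIntegrable f volume 0 τ) :
    IntervalIntegrable (fun s => ⟪p s, f s⟫_ℝ) volume 0 τ := by
  obtain ⟨C, hC⟩ := isCompact_uIcc.exists_bound_of_continuousOn
    (hp.continuousOn (s := uIcc 0 τ))
  refine (hf.norm.const_mul C).mono_fun'
    (hp.aestronglyMeasurable.inner hf.aestronglyMeasurable_restrict_uIoc) ?_
  filter_upwards [ae_restrict_mem measurableSet_uIoc] with s hs
  refine (norm_inner_le_norm _ _).trans ?_
  gcongr
  exact hC s (uIoc_subset_uIcc hs)

/-- The backward mild integral `p` of `g`, given in weak form, is adjoint to the forward mild integral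
of `f`: this is Fubini's theorem on the triangle `0 < s ≤ t ≤ τ`. -/
theorem IsBoundedFamily.integral_inner_conv [CompleteSpace X] {S : ℝ → X →L[ℝ] X} {M τ : ℝ}
    (hS : IsBoundedFamily S M) (hτ : 0 ≤ τ) {f g p : ℝ → X}
    (hf : IntervalIntegrable f volume 0 τ) (hg : IntervalIntegrable g volume 0 τ)
    (hp : ∀ t ∈ Icc 0 τ, ∀ y, ⟪p t, y⟫_ℝ = ∫ s in t..τ, ⟪g s, S (s - t) y⟫_ℝ) :
    ∫ t in (0 : ℝ)..τ, ⟪g t, conv S f t⟫_ℝ = ∫ s in (0 : ℝ)..τ, ⟪p s, f s⟫_ℝ := by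
  have hf' := (intervalIntegrable_iff_integrableOn_Ioc_of_le hτ).1 hf
  have hg' := (intervalIntegrable_iff_integrableOn_Ioc_of_le hτ).1 hg
  set ν := volume.restrict (Ioc (0 : ℝ) τ) with hν
  set Φ : ℝ → ℝ → ℝ := fun t s =>
    {q : ℝ × ℝ | q.2 ≤ q.1}.indicator (fun q => ⟪g q.1, S (q.1 - q.2) (f q.2)⟫_ℝ) (t, s) with hΦ
  have hmeas : MeasurableSet {q : ℝ × ℝ | q.2 ≤ q.1} :=
    measurableSet_le measurable_snd measurable_fst
  have hint : Integrable (Function.uncurry Φ) (ν.prod ν) := by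
    refine Integrable.mono' ((hg'.norm.mul_prod hf'.norm).const_mul M) ?_
      (ae_of_all _ fun q => ?_)
    · refine AEStronglyMeasurable.indicator (f := fun q : ℝ × ℝ =>
        ⟪g q.1, S (q.1 - q.2) (f q.2)⟫_ℝ) ?_ hmeas
      refine hg'.1.comp_fst.inner (hS.continuous_uncurry.comp_aestronglyMeasurable
        (AEStronglyMeasurable.prodMk (by fun_prop) hf'.1.comp_snd))
    · refine (norm_indicator_le_norm_self (fun q : ℝ × ℝ =>
        ⟪g q.1, S (q.1 - q.2) (f q.2)⟫_ℝ) _).trans ((norm_inner_le_norm _ _).trans ?_)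
      calc ‖g q.1‖ * ‖S (q.1 - q.2) (f q.2)‖ ≤ ‖g q.1‖ * (M * ‖f q.2‖) := by
            gcongr; exact hS.norm_apply_le _ _
        _ = _ := by ring
  have h1 : ∫ t in (0 : ℝ)..τ, ⟪g t, conv S f t⟫_ℝ = ∫ t, ∫ s, Φ t s ∂ν ∂ν := by
    rw [intervalIntegral.integral_of_le hτ]
    refine setIntegral_congr_fun measurableSet_Ioc fun t ht => ?_
    have he : ∀ s, Φ t s = (Iic t).indicator (fun s => ⟪g t, S (t - s) (f s)⟫_ℝ) s := fun s => rfl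
    have hi := hS.intervalIntegrable
      (intervalIntegrable_initial hf (Ioc_subset_Icc_self ht)) t
    simp only [he]
    rw [integral_indicator measurableSet_Iic, hν, Measure.restrict_restrict measurableSet_Iic,
      inter_comm, Ioc_inter_Iic, min_eq_right ht.2, conv, intervalIntegral.integral_of_le ht.1.le,
      integral_inner ((intervalIntegrable_iff_integrableOn_Ioc_of_le ht.1.le).1 hi)]
  have h2 : ∫ s in (0 : ℝ)..τ, ⟪p s, f s⟫_ℝ = ∫ s, ∫ t, Φ t s ∂ν ∂ν := by
    rw [intervalIntegral.integral_of_le hτ]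
    refine setIntegral_congr_fun measurableSet_Ioc fun s hs => ?_
    have he : ∀ t, Φ t s = (Ici s).indicator (fun t => ⟪g t, S (t - s) (f s)⟫_ℝ) t := fun t => rfl
    have hset : Ici s ∩ Ioc 0 τ = Icc s τ := by
      ext t
      simp only [mem_inter_iff, mem_Ici, mem_Ioc, mem_Icc]
      exact ⟨fun h => ⟨h.1, h.2.2⟩, fun h => ⟨h.1, hs.1.trans_le h.1, h.2⟩⟩
    simp only [he]
    rw [integral_indicator measurableSet_Ici, hν, Measure.restrict_restrict measurableSet_Ici,
      hset, integral_Icc_eq_integral_Ioc, hp s (Ioc_subset_Icc_self hs) (f s),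
      intervalIntegral.integral_of_le hs.2]
  rw [h1, h2]
  exact integral_integral_swap hint

/-- The adjoint state eliminates the linearized state: the terms `⟪p, F'(x) z⟫` cancel in the duality
between the two mild integrals. -/
theorem integral_inner_linearized_eq [CompleteSpace X] [TopologicalSpace.SeparableSpace X]
    {F : X → X} {F' : X → X →L[ℝ] X} (hF : HasGateauxDeriv F F') (hF' : MapsBoundedOn F' univ)
    {S : ℝ → X →L[ℝ] X} {M τ : ℝ} (hS : IsBoundedFamily S M) (hτ : 0 ≤ τ)
    {Q : X →L[ℝ] X} {x p z γ : ℝ → X} (hx : Continuous x) (hpc : Continuous p)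
    (hp : IsAdjointMildSolution S F' Q τ x p) (hz : Continuous z)
    (hzi : IntervalIntegrable (fun s => F' (x s) (z s)) volume 0 τ)
    (hγ : IntervalIntegrable γ volume 0 τ)
    (hzeq : ∀ t ∈ Icc 0 τ, z t = conv S (fun s => F' (x s) (z s) + γ s) t) :
    ∫ t in (0 : ℝ)..τ, ⟪Q (x t), z t⟫_ℝ = ∫ t in (0 : ℝ)..τ, ⟪p t, γ t⟫_ℝ := by
  borelize X
  have : SecondCountableTopology X := UniformSpace.secondCountable_of_separable X
  set g : ℝ → X := fun s => ((F' (x s))†) (p s) + Q (x s) with hg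
  have hginner : ∀ s y, ⟪g s, y⟫_ℝ = ⟪p s, F' (x s) y⟫_ℝ + ⟪Q (x s), y⟫_ℝ := fun s y => by
    rw [hg, inner_add_left, ContinuousLinearMap.adjoint_inner_left]
  have hgm : Measurable g := by
    refine measurable_of_inner fun y => ?_
    simp only [hginner]
    have h1 := hpc.stronglyMeasurable.inner (𝕜 := ℝ)
      (hF.stronglyMeasurable hF' hx (continuous_const (y := y)))
    have h2 : Continuous fun s => ⟪Q (x s), y⟫_ℝ := by fun_prop
    exact h1.measurable.add h2.measurable
  obtain ⟨r, hr⟩ := isCompact_Icc.exists_bound_of_continuousOn (hx.continuousOn (s := Icc 0 τ))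
  obtain ⟨L, -, hL, -⟩ := exists_lipschitz_closedBall hF hF' r
  have hgi : IntervalIntegrable g volume 0 τ := by
    refine IntervalIntegrable.mono_fun' (g := fun s => L * ‖p s‖ + ‖Q (x s)‖)
      (Continuous.intervalIntegrable (by fun_prop) _ _) hgm.aestronglyMeasurable ?_
    rw [uIoc_of_le hτ]
    filter_upwards [ae_restrict_mem measurableSet_Ioc] with s hs
    refine (norm_add_le _ _).trans (add_le_add_left ?_ _)
    refine ContinuousLinearMap.le_of_opNorm_le _ ?_ _
    rw [LinearIsometryEquiv.norm_map]
    exact hL _ (hr s (Ioc_subset_Icc_self hs))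
  have hdual := hS.integral_inner_conv hτ (hzi.add hγ) hgi (p := p) (by
    intro t ht y
    obtain ⟨hi, he⟩ := hp.2 t ht
    rw [he, real_inner_comm, intervalIntegral.integral_of_le ht.2,
      ← integral_inner ((intervalIntegrable_iff_integrableOn_Ioc_of_le ht.2).1 hi),
      intervalIntegral.integral_of_le ht.2]
    refine integral_congr_ae (ae_of_all _ fun s => ?_)
    change ⟪y, ((S (s - t))†) (g s)⟫_ℝ = ⟪g s, S (s - t) y⟫_ℝ
    rw [ContinuousLinearMap.adjoint_inner_right, real_inner_comm])
  have h1 : ∫ t in (0 : ℝ)..τ, ⟪g t, conv S (fun s => F' (x s) (z s) + γ s) t⟫_ℝ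
      = (∫ t in (0 : ℝ)..τ, ⟪p t, F' (x t) (z t)⟫_ℝ) + ∫ t in (0 : ℝ)..τ, ⟪Q (x t), z t⟫_ℝ := by
    rw [← intervalIntegral.integral_add (intervalIntegrable_inner hpc hzi)
      (Continuous.intervalIntegrable (by fun_prop) _ _)]
    refine intervalIntegral.integral_congr fun t ht => ?_
    rw [uIcc_of_le hτ] at ht
    rw [← hzeq t ht, hginner]
  have h2 : ∫ t in (0 : ℝ)..τ, ⟪p t, F' (x t) (z t) + γ t⟫_ℝ
      = (∫ t in (0 : ℝ)..τ, ⟪p t, F' (x t) (z t)⟫_ℝ) + ∫ t in (0 : ℝ)..τ, ⟪p t, γ t⟫_ℝ := by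
    rw [← intervalIntegral.integral_add (intervalIntegrable_inner hpc hzi)
      (intervalIntegrable_inner hpc hγ)]
    simp only [inner_add_right]
  rw [h1, h2] at hdual
  exact add_left_cancel hdual

end Duality

/-! ### First-order expansion of the cost -/

/-- The right limit gives `0 ≤ D`, the left limit `D ≤ 0`. -/
theorem eq_zero_of_eventually_nonneg {D : ℝ} {κ : ℝ → ℝ} (hκ : Tendsto κ (𝓝[≠] 0) (𝓝 0))
    (h : ∀ᶠ e in 𝓝[≠] (0 : ℝ), 0 ≤ e * D + |e| * κ e) : D = 0 := by
  have hr : 𝓝[>] (0 : ℝ) ≤ 𝓝[≠] 0 := nhdsWithin_mono _ fun e he => ne_of_gt he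
  have hl : 𝓝[<] (0 : ℝ) ≤ 𝓝[≠] 0 := nhdsWithin_mono _ fun e he => ne_of_lt he
  refine le_antisymm ?_ ?_
  · refine le_of_tendsto_of_tendsto tendsto_const_nhds (hκ.mono_left hl) ?_
    filter_upwards [h.filter_mono hl, self_mem_nhdsWithin] with e he he0
    rw [abs_of_neg he0] at he
    have : e < 0 := he0
    nlinarith
  · have hκ' := (hκ.mono_left hr).neg
    rw [neg_zero] at hκ'
    refine le_of_tendsto_of_tendsto hκ' tendsto_const_nhds ?_
    filter_upwards [h.filter_mono hr, self_mem_nhdsWithin] with e he he0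
    rw [abs_of_pos he0] at he
    have : 0 < e := he0
    nlinarith

theorem intervalIntegrable_L2 {U : Type*} [NormedAddCommGroup U] {τ : ℝ} (hτ : 0 ≤ τ) (u : L2 τ U) :
    IntervalIntegrable (fun s => u s) volume 0 τ := by
  rw [intervalIntegrable_iff_integrableOn_Ioc_of_le hτ]
  exact (Lp.memLp u).integrable (by norm_num)

section Cost

variable {X U : Type*} [NormedAddCommGroup X] [InnerProductSpace ℝ X]
    [NormedAddCommGroup U] [InnerProductSpace ℝ U]

theorem intervalIntegrable_inner_L2 {τ : ℝ} (hτ : 0 ≤ τ) (R : U →L[ℝ] U) (u v : L2 τ U) :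
    IntervalIntegrable (fun s => ⟪R (u s), v s⟫_ℝ) volume 0 τ := by
  rw [intervalIntegrable_iff_integrableOn_Ioc_of_le hτ]
  refine (L2.integrable_inner (𝕜 := ℝ) (R.compLp u) v).congr ?_
  filter_upwards [R.coeFn_compLp u] with s hs
  rw [hs]

theorem inner_quadratic_expand {Q : X →L[ℝ] X} (hQ : ∀ x y, ⟪Q x, y⟫_ℝ = ⟪x, Q y⟫_ℝ) (x y : X) :
    ⟪Q (x + y), x + y⟫_ℝ = ⟪Q x, x⟫_ℝ + 2 * ⟪Q x, y⟫_ℝ + ⟪Q y, y⟫_ℝ := by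
  rw [map_add, inner_add_left, inner_add_right, inner_add_right, hQ y x, real_inner_comm (Q x) y]
  ring

theorem abs_inner_apply_le (Q : X →L[ℝ] X) (x y : X) : |⟪Q x, y⟫_ℝ| ≤ ‖Q‖ * ‖x‖ * ‖y‖ :=
  (abs_real_inner_le_norm _ _).trans (by gcongr; exact Q.le_opNorm x)

/-- Along `u + e v` and trajectories `x e = xo + e z + o(e)`, the cost is at most its first-order
expansion plus `o(e)`. -/
theorem exists_cost_expansion {Q : X →L[ℝ] X} (hQ : ∀ x y, ⟪Q x, y⟫_ℝ = ⟪x, Q y⟫_ℝ)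
    {R : U →L[ℝ] U} (hR : ∀ x y, ⟪R x, y⟫_ℝ = ⟪x, R y⟫_ℝ) {τ : ℝ} (hτ : 0 ≤ τ)
    {xo z : ℝ → X} {x : ℝ → ℝ → X} {η : ℝ → ℝ} (hxo : Continuous xo) (hz : Continuous z)
    (hx : ∀ e, Continuous (x e)) (hη : Tendsto η (𝓝[≠] 0) (𝓝 0)) (u v : L2 τ U)
    (h : ∀ᶠ e in 𝓝[≠] (0 : ℝ), ∀ t ∈ Icc 0 τ, ‖x e t - xo t - e • z t‖ ≤ |e| * η e) :
    ∃ κ : ℝ → ℝ, Tendsto κ (𝓝[≠] 0) (𝓝 0) ∧ ∀ᶠ e in 𝓝[≠] (0 : ℝ),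
      cost Q R τ (x e) (u + e • v) ≤ cost Q R τ xo u
        + e * (2 * ((∫ t in (0 : ℝ)..τ, ⟪Q (xo t), z t⟫_ℝ) + ∫ t in (0 : ℝ)..τ, ⟪R (u t), v t⟫_ℝ))
        + |e| * κ e := by
  obtain ⟨r, hr⟩ := isCompact_Icc.exists_bound_of_continuousOn
    (hxo.continuousOn (s := Icc 0 τ))
  obtain ⟨Z, hZ⟩ := isCompact_Icc.exists_bound_of_continuousOn
    (hz.continuousOn (s := Icc 0 τ))
  set V := ∫ t in (0 : ℝ)..τ, ⟪R (v t), v t⟫_ℝ with hV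
  set k : ℝ → ℝ := fun e => 2 * (‖Q‖ * r * η e) + ‖Q‖ * |e| * (Z + η e) ^ 2 with hk
  have habs : Tendsto (fun e : ℝ => |e|) (𝓝[≠] 0) (𝓝 0) := by
    have := (continuous_abs (G := ℝ)).tendsto 0
    rw [abs_zero] at this
    exact this.mono_left nhdsWithin_le_nhds
  have hklim : Tendsto k (𝓝[≠] 0) (𝓝 0) := by
    have h1 := ((hη.const_mul (‖Q‖ * r)).const_mul 2).add
      ((habs.const_mul ‖Q‖).mul ((hη.const_add Z).pow 2))
    simpa using h1
  refine ⟨fun e => τ * k e + |e| * V, by simpa using (hklim.const_mul τ).add (habs.mul_const V), ?_⟩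
  filter_upwards [h] with e he
  have hxec := hx e
  have hpt : ∀ t ∈ Icc 0 τ, ⟪Q (x e t), x e t⟫_ℝ
      ≤ ⟪Q (xo t), xo t⟫_ℝ + e * (2 * ⟪Q (xo t), z t⟫_ℝ) + |e| * k e := by
    intro t ht
    set w := x e t - xo t - e • z t with hw
    have hwn : ‖w‖ ≤ |e| * η e := he t ht
    have hη0 : 0 ≤ |e| * η e := (norm_nonneg _).trans hwn
    have hd : ‖e • z t + w‖ ≤ |e| * (Z + η e) := by
      refine (norm_add_le _ _).trans ?_
      rw [norm_smul, Real.norm_eq_abs, mul_add]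
      gcongr
      exact hZ t ht
    have h1 : x e t = xo t + (e • z t + w) := by rw [hw]; abel
    have h2 : ⟪Q (xo t), w⟫_ℝ ≤ ‖Q‖ * r * (|e| * η e) := by
      refine (le_abs_self _).trans ((abs_inner_apply_le _ _ _).trans ?_)
      have := (norm_nonneg _).trans (hr t ht)
      gcongr
      exact hr t ht
    have h3 : ⟪Q (e • z t + w), e • z t + w⟫_ℝ ≤ ‖Q‖ * (|e| * (Z + η e)) ^ 2 := by
      refine (le_abs_self _).trans ((abs_inner_apply_le _ _ _).trans ?_)
      rw [mul_assoc, ← sq]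
      gcongr
    rw [h1, inner_quadratic_expand hQ, inner_add_right, inner_smul_right]
    simp only [hk]
    calc _ ≤ ⟪Q (xo t), xo t⟫_ℝ + 2 * (e * ⟪Q (xo t), z t⟫_ℝ + ‖Q‖ * r * (|e| * η e))
          + ‖Q‖ * (|e| * (Z + η e)) ^ 2 := by gcongr
      _ = _ := by ring
  have hi1 : IntervalIntegrable (fun t => ⟪Q (x e t), x e t⟫_ℝ) volume 0 τ :=
    Continuous.intervalIntegrable (by fun_prop) _ _
  have hi2 : IntervalIntegrable (fun t => ⟪Q (xo t), xo t⟫_ℝ) volume 0 τ :=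
    Continuous.intervalIntegrable (by fun_prop) _ _
  have hi3 : IntervalIntegrable (fun t => e * (2 * ⟪Q (xo t), z t⟫_ℝ)) volume 0 τ :=
    Continuous.intervalIntegrable (by fun_prop) _ _
  have hQint : ∫ t in (0 : ℝ)..τ, ⟪Q (x e t), x e t⟫_ℝ ≤ (∫ t in (0 : ℝ)..τ, ⟪Q (xo t), xo t⟫_ℝ)
      + e * (2 * ∫ t in (0 : ℝ)..τ, ⟪Q (xo t), z t⟫_ℝ) + τ * (|e| * k e) := by
    refine (intervalIntegral.integral_mono_on hτ hi1
      ((hi2.add hi3).add intervalIntegrable_const) hpt).trans_eq ?_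
    rw [intervalIntegral.integral_add (hi2.add hi3) intervalIntegrable_const,
      intervalIntegral.integral_add hi2 hi3, intervalIntegral.integral_const_mul,
      intervalIntegral.integral_const_mul, intervalIntegral.integral_const]
    simp
  have hR1 := intervalIntegrable_inner_L2 hτ R u u
  have hR2 := (intervalIntegrable_inner_L2 hτ R u v).const_mul (2 * e)
  have hR3 := (intervalIntegrable_inner_L2 hτ R v v).const_mul (e ^ 2)
  have hRint : ∫ t in (0 : ℝ)..τ, ⟪R ((u + e • v : L2 τ U) t), (u + e • v : L2 τ U) t⟫_ℝ
      = (∫ t in (0 : ℝ)..τ, ⟪R (u t), u t⟫_ℝ) + 2 * e * (∫ t in (0 : ℝ)..τ, ⟪R (u t), v t⟫_ℝ)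
        + e ^ 2 * V := by
    rw [hV, ← intervalIntegral.integral_const_mul, ← intervalIntegral.integral_const_mul,
      ← intervalIntegral.integral_add hR1 hR2, ← intervalIntegral.integral_add (hR1.add hR2) hR3]
    refine intervalIntegral.integral_congr_ae ?_
    rw [uIoc_of_le hτ, ← ae_restrict_iff' measurableSet_Ioc]
    filter_upwards [Lp.coeFn_add u (e • v), Lp.coeFn_smul e v] with t h1 h2
    rw [h1, Pi.add_apply, h2, Pi.smul_apply, inner_quadratic_expand hR, inner_smul_right, map_smul,
      inner_smul_left, inner_smul_right]
    simp only [conj_trivial]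
    ring
  simp only [cost]
  rw [intervalIntegral.integral_add hi1 (intervalIntegrable_inner_L2 hτ R _ _),
    intervalIntegral.integral_add hi2 hR1, hRint]
  have hsq : e ^ 2 = |e| * |e| := by rw [← sq, sq_abs]
  rw [hsq]
  linarith

end Cost

/-! ### Perturbation of the input and of the actuator design -/

section Input

variable {X U : Type*} [NormedAddCommGroup X] [NormedSpace ℝ X]
    [NormedAddCommGroup U] [NormedSpace ℝ U]

theorem intervalIntegrable_clm_L2 {τ : ℝ} (hτ : 0 ≤ τ) (b : U →L[ℝ] X) (u : L2 τ U) :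
    IntervalIntegrable (fun s => b (u s)) volume 0 τ := by
  have h := intervalIntegrable_L2 hτ u
  rw [intervalIntegrable_iff] at h ⊢
  exact b.integrable_comp h

/-- The forcing term `b e (u + e v)` is differentiable in `L¹` at `e = 0`; here `b e` is the input
operator along a line of designs. -/
theorem exists_input_expansion {τ : ℝ} (hτ : 0 ≤ τ) {b : ℝ → U →L[ℝ] X} {b' : U →L[ℝ] X}
    (hb : HasDerivAt b b' 0) (u v : L2 τ U) :
    ∃ δ : ℝ → ℝ, Tendsto δ (𝓝[≠] 0) (𝓝 0) ∧ ∀ᶠ e in 𝓝[≠] (0 : ℝ),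
      ∫ s in (0 : ℝ)..τ, ‖b e ((u + e • v : L2 τ U) s) - b 0 ((u + (0 : ℝ) • v : L2 τ U) s)
        - e • (b 0 (v s) + b' (u s))‖ ≤ |e| * δ e := by
  have h1 : Tendsto (fun e : ℝ => ‖e⁻¹ • (b e - b 0) - b'‖) (𝓝[≠] 0) (𝓝 0) := by
    have h := hasDerivAt_iff_tendsto_slope_zero.1 hb
    simpa using (h.sub_const b').norm
  have h2 : Tendsto (fun e : ℝ => ‖b e - b 0‖) (𝓝[≠] 0) (𝓝 0) := by
    have h : Tendsto b (𝓝[≠] 0) (𝓝 (b 0)) := hb.continuousAt.tendsto.mono_left nhdsWithin_le_nhds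
    simpa using (h.sub_const (b 0)).norm
  refine ⟨fun e => ‖e⁻¹ • (b e - b 0) - b'‖ * (∫ s in (0 : ℝ)..τ, ‖u s‖)
    + ‖b e - b 0‖ * ∫ s in (0 : ℝ)..τ, ‖v s‖, ?_, ?_⟩
  · simpa using (h1.mul_const (∫ s in (0 : ℝ)..τ, ‖u s‖)).add
      (h2.mul_const (∫ s in (0 : ℝ)..τ, ‖v s‖))
  filter_upwards [self_mem_nhdsWithin] with e he
  have he0 : e ≠ 0 := he
  have hu := (intervalIntegrable_L2 hτ u).norm
  have hv := (intervalIntegrable_L2 hτ v).norm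
  have hub := hu.const_mul ‖e⁻¹ • (b e - b 0) - b'‖
  have hvb := hv.const_mul ‖b e - b 0‖
  rw [← intervalIntegral.integral_const_mul, ← intervalIntegral.integral_const_mul,
    ← intervalIntegral.integral_add hub hvb, ← intervalIntegral.integral_const_mul,
    intervalIntegral.integral_of_le hτ, intervalIntegral.integral_of_le hτ]
  refine integral_mono_of_nonneg (ae_of_all _ fun s => norm_nonneg _)
    ((intervalIntegrable_iff_integrableOn_Ioc_of_le hτ).1 ((hub.add hvb).const_mul |e|)) ?_
  filter_upwards [Lp.coeFn_add u (e • v), Lp.coeFn_smul e v, Lp.coeFn_add u ((0 : ℝ) • v),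
    Lp.coeFn_smul (0 : ℝ) v] with s a1 a2 a3 a4
  rw [a1, Pi.add_apply, a2, Pi.smul_apply, a3, Pi.add_apply, a4, Pi.smul_apply, zero_smul, add_zero]
  have hsplit : b e (u s + e • v s) - b 0 (u s) - e • (b 0 (v s) + b' (u s))
      = e • ((e⁻¹ • (b e - b 0) - b') (u s) + (b e - b 0) (v s)) := by
    simp only [map_add, map_smul, sub_apply, smul_apply,
      smul_add, smul_sub, smul_smul, mul_inv_cancel₀ he0, one_smul]
    abel
  rw [hsplit, norm_smul, Real.norm_eq_abs]
  gcongr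
  exact (norm_add_le _ _).trans
    (add_le_add (ContinuousLinearMap.le_opNorm _ _) (ContinuousLinearMap.le_opNorm _ _))

end Input

theorem HasGateauxDerivOn.hasDerivAt {E G : Type*} [NormedAddCommGroup E] [NormedSpace ℝ E]
    [NormedAddCommGroup G] [NormedSpace ℝ G] {f : E → G} {f' : E → E →L[ℝ] G} {S : Set E}
    (hf : HasGateauxDerivOn f f' S) {x : E} (hx : S ∈ 𝓝 x) (h : E) :
    HasDerivAt (fun t : ℝ => f (x + t • h)) (f' x h) 0 := by
  have h1 := hf x (mem_of_mem_nhds hx) h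
  have hc : Continuous fun t : ℝ => x + t • h := by fun_prop
  exact HasDerivWithinAt.hasDerivAt h1 (hc.continuousAt.preimage_mem_nhds (by simpa using hx))

/-! ### Restriction of the data to the time interval -/

theorem exists_continuous_eqOn_Icc {X : Type*} [TopologicalSpace X] {x : ℝ → X} {τ : ℝ} (hτ : 0 ≤ τ)
    (hx : ContinuousOn x (Icc 0 τ)) : ∃ y : ℝ → X, Continuous y ∧ ∀ t ∈ Icc 0 τ, y t = x t :=
  ⟨fun t => x (projIcc 0 τ hτ t), hx.comp_continuous
    (continuous_subtype_val.comp continuous_projIcc) fun t => (projIcc 0 τ hτ t).2,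
    fun t ht => by simp only [projIcc_of_mem hτ ht]⟩

section Clamp

variable {X : Type*} [NormedAddCommGroup X] [NormedSpace ℝ X]

/-- Freezing the semigroup outside `[0, τ]` changes none of the mild integrals on `[0, τ]`. -/
theorem IsC0Semigroup.exists_isBoundedFamily [CompleteSpace X] {T : ℝ → X →L[ℝ] X}
    (hT : IsC0Semigroup T) {τ : ℝ} (hτ : 0 ≤ τ) :
    ∃ (S : ℝ → X →L[ℝ] X) (M : ℝ), IsBoundedFamily S M ∧ ∀ t ∈ Icc 0 τ, S t = T t := by
  have hc : ∀ x : X, ContinuousOn (fun t => T t x) (Icc 0 τ) := fun x =>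
    (hT.strongly_continuous x).mono Icc_subset_Ici_self
  obtain ⟨M, hM, hb⟩ := exists_bound_of_strongly_continuous hc
  exact ⟨fun t => T (projIcc 0 τ hτ t), M,
    ⟨hM, fun t => hb _ (projIcc 0 τ hτ t).2, fun x => (hc x).comp_continuous
      (continuous_subtype_val.comp continuous_projIcc) fun t => (projIcc 0 τ hτ t).2⟩,
    fun t ht => by simp only [projIcc_of_mem hτ ht]⟩

variable {S T : ℝ → X →L[ℝ] X} {τ : ℝ}

theorem IsMildSolution.congr {U : Type*} [NormedAddCommGroup U] [NormedSpace ℝ U]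
    {F : X → X} {b : U →L[ℝ] X} {x₀ : X} {u : L2 τ U} {x y : ℝ → X}
    (h : IsMildSolution T F b τ x₀ u x) (hST : ∀ t ∈ Icc 0 τ, S t = T t)
    (hxy : ∀ t ∈ Icc 0 τ, y t = x t) : IsMildSolution S F b τ x₀ u y := by
  refine ⟨h.1.congr hxy, fun t ht => ?_⟩
  obtain ⟨h1, h2, h3⟩ := h.2 t ht
  have hs : ∀ s ∈ uIcc 0 t, s ∈ Icc 0 τ ∧ t - s ∈ Icc 0 τ := fun s hs => by
    rw [uIcc_of_le ht.1] at hs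
    exact ⟨⟨hs.1, hs.2.trans ht.2⟩, ⟨sub_nonneg.2 hs.2, by linarith [hs.1, ht.2]⟩⟩
  have e1 : EqOn (fun s => T (t - s) (F (x s))) (fun s => S (t - s) (F (y s))) (uIcc 0 t) :=
    fun s h => by simp only [hST _ (hs s h).2, hxy _ (hs s h).1]
  have e2 : EqOn (fun s => T (t - s) (b (u s))) (fun s => S (t - s) (b (u s))) (uIcc 0 t) :=
    fun s h => by simp only [hST _ (hs s h).2]
  refine ⟨h1.congr (e1.mono uIoc_subset_uIcc), h2.congr (e2.mono uIoc_subset_uIcc), ?_⟩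
  rw [hxy t ht, h3, hST t ht, intervalIntegral.integral_congr e1,
    intervalIntegral.integral_congr e2]

theorem IsAdjointMildSolution.congr {X : Type*} [NormedAddCommGroup X] [InnerProductSpace ℝ X]
    [CompleteSpace X] {S T : ℝ → X →L[ℝ] X} {F' : X → X →L[ℝ] X} {Q : X →L[ℝ] X}
    {x y p q : ℝ → X} (h : IsAdjointMildSolution T F' Q τ x p)
    (hST : ∀ t ∈ Icc 0 τ, S t = T t) (hxy : ∀ t ∈ Icc 0 τ, y t = x t)
    (hpq : ∀ t ∈ Icc 0 τ, q t = p t) : IsAdjointMildSolution S F' Q τ y q := by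
  refine ⟨h.1.congr hpq, fun t ht => ?_⟩
  obtain ⟨h1, h2⟩ := h.2 t ht
  have e : EqOn (fun s => ((T (s - t))†) (((F' (x s))†) (p s) + Q (x s)))
      (fun s => ((S (s - t))†) (((F' (y s))†) (q s) + Q (y s))) (uIcc t τ) := fun s hs => by
    rw [uIcc_of_le ht.2] at hs
    have hs1 : s ∈ Icc 0 τ := ⟨ht.1.trans hs.1, hs.2⟩
    have hs2 : s - t ∈ Icc 0 τ := ⟨sub_nonneg.2 hs.1, by linarith [hs.2, ht.1]⟩
    simp only [hST _ hs2, hxy _ hs1, hpq _ hs1]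
  exact ⟨h1.congr (e.mono uIoc_subset_uIcc), by
    rw [hpq t ht, h2, intervalIntegral.integral_congr e]⟩

theorem cost_congr {X U : Type*} [NormedAddCommGroup X] [InnerProductSpace ℝ X]
    [NormedAddCommGroup U] [InnerProductSpace ℝ U] {Q : X →L[ℝ] X} {R : U →L[ℝ] U} {τ : ℝ}
    (hτ : 0 ≤ τ) {x y : ℝ → X} (u : L2 τ U) (hxy : ∀ t ∈ Icc 0 τ, x t = y t) :
    cost Q R τ x u = cost Q R τ y u := by
  refine intervalIntegral.integral_congr fun t ht => ?_
  rw [uIcc_of_le hτ] at ht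
  simp only [hxy t ht]

theorem isMildSolution_of_conv {U : Type*} [NormedAddCommGroup U] [NormedSpace ℝ U]
    {F : X → X} (hF : Continuous F) {M : ℝ} (hS : IsBoundedFamily S M) (hτ : 0 ≤ τ)
    {b : U →L[ℝ] X} {x₀ : X} {u : L2 τ U} {x : ℝ → X} (hx : Continuous x)
    (h : ∀ t ∈ Icc 0 τ, x t = S t x₀ + conv S (fun s => F (x s)) t
      + conv S (fun s => b (u s)) t) : IsMildSolution S F b τ x₀ u x :=
  ⟨hx.continuousOn, fun t ht =>
    ⟨hS.intervalIntegrable (Continuous.intervalIntegrable (by fun_prop) _ _) t,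
      hS.intervalIntegrable (intervalIntegrable_initial (intervalIntegrable_clm_L2 hτ b u) ht) t,
      h t ht⟩⟩

end Clamp

/-! ### First-order optimality conditions -/

section Optimality

variable {X U K : Type*}
    [NormedAddCommGroup X] [InnerProductSpace ℝ X] [CompleteSpace X]
    [NormedAddCommGroup U] [InnerProductSpace ℝ U]
    [NormedAddCommGroup K] [NormedSpace ℝ K]

/-- Vanishing of the directional derivative of the cost at a local minimizer, in the input direction
`v` and the design direction `h` jointly, expressed through the adjoint state. -/
theorem variational_identity [TopologicalSpace.SeparableSpace X]
    {T : ℝ → X →L[ℝ] X} (hT : IsC0Semigroup T)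
    {F : X → X} {F' : X → X →L[ℝ] X} (hF : HasGateauxDeriv F F') (hF' : MapsBoundedOn F' univ)
    {Kad : Set K} {B : K → U →L[ℝ] X} {B' : K → K →L[ℝ] (U →L[ℝ] X)}
    (hB : HasGateauxDerivOn B B' Kad) {Q : X →L[ℝ] X} (hQ : ∀ x y, ⟪Q x, y⟫_ℝ = ⟪x, Q y⟫_ℝ)
    {R : U →L[ℝ] U} (hR : ∀ x y, ⟪R x, y⟫_ℝ = ⟪x, R y⟫_ℝ)
    {τ : ℝ} (hτ : 0 ≤ τ) {ρ : ℝ} {x₀ : X} {uo : L2 τ U} {ro : K} {xo : ℝ → X}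
    (hmin : IsLocalMinimizer T F B Q R τ ρ Kad x₀ uo ro xo)
    (hint : (uo, ro) ∈ interior (admissibleInputs τ ρ U ×ˢ Kad))
    {p : ℝ → X} (hp : IsAdjointMildSolution T F' Q τ xo p) (v : L2 τ U) (h : K) :
    (∫ t in (0 : ℝ)..τ, ⟪p t, B ro (v t) + B' ro h (uo t)⟫_ℝ)
      + ∫ t in (0 : ℝ)..τ, ⟪R (uo t), v t⟫_ℝ = 0 := by
  have hFc := hF.continuous hF'
  obtain ⟨S, M, hS, hST⟩ := hT.exists_isBoundedFamily hτ
  obtain ⟨-, -, hxo, hloc⟩ := hmin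
  obtain ⟨y, hyc, hy⟩ := exists_continuous_eqOn_Icc hτ hxo.1
  obtain ⟨q, hqc, hq⟩ := exists_continuous_eqOn_Icc hτ hp.1
  have hymild := hxo.congr hST hy
  have hqadj := hp.congr hST hy hq
  have hKad : Kad ∈ 𝓝 ro := by
    have h1 := mem_interior_iff_mem_nhds.1 hint
    rw [nhds_prod_eq] at h1
    exact (prod_mem_prod_iff.1 h1).2
  have hb := hB.hasDerivAt hKad h
  obtain ⟨δ, hδ, hδβ⟩ := exists_input_expansion hτ hb uo v
  set β : ℝ → ℝ → X := fun e s => B (ro + e • h) ((uo + e • v : L2 τ U) s) with hβdef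
  have hβ : ∀ e, IntervalIntegrable (β e) volume 0 τ := fun e =>
    intervalIntegrable_clm_L2 hτ _ _
  have hγ : IntervalIntegrable (fun s => B (ro + (0 : ℝ) • h) (v s) + B' ro h (uo s))
      volume 0 τ :=
    (intervalIntegrable_clm_L2 hτ _ _).add (intervalIntegrable_clm_L2 hτ _ _)
  obtain ⟨z, x, η, hz, hxc, hzi, hzeq, hη, hev⟩ := exists_variation hF hF' hS hτ
    (a := fun t => S t x₀) (hS.cont x₀).continuousOn hyc hβ hγ (fun t ht => by
      have h0 : β 0 = fun s => B ro (uo s) := by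
        simp only [hβdef, zero_smul, add_zero]
      rw [h0]
      exact (hymild.2 t ht).2.2) hδ hδβ
  have hdual := integral_inner_linearized_eq hF hF' hS hτ hyc hqc hqadj hz hzi hγ hzeq
  obtain ⟨κ, hκ, hcost⟩ := exists_cost_expansion hQ hR hτ hyc hz hxc hη uo v
    (hev.mono fun e he => he.2)
  have hlim : Tendsto (fun e : ℝ => (uo + e • v, ro + e • h)) (𝓝[≠] 0) (𝓝 (uo, ro)) := by
    have hc : Continuous fun e : ℝ => (uo + e • v, ro + e • h) := by fun_prop
    have := hc.tendsto 0
    simp only [zero_smul, add_zero] at this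
    exact this.mono_left nhdsWithin_le_nhds
  have hD : 2 * ((∫ t in (0 : ℝ)..τ, ⟪Q (y t), z t⟫_ℝ)
      + ∫ t in (0 : ℝ)..τ, ⟪R (uo t), v t⟫_ℝ) = 0 := eq_zero_of_eventually_nonneg hκ (by
    filter_upwards [hcost, hev, hlim.eventually hloc,
      hlim.eventually (mem_interior_iff_mem_nhds.1 hint)] with e h1 h2 h3 h4
    have h5 := h3 h4.1 h4.2 (x e) ((isMildSolution_of_conv hFc hS hτ (hxc e) h2.1).congr
      (fun t ht => (hST t ht).symm) fun t _ => rfl)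
    rw [cost_congr hτ uo fun t ht => (hy t ht).symm] at h5
    linarith)
  rw [hdual] at hD
  have hpq : ∫ t in (0 : ℝ)..τ, ⟪p t, B ro (v t) + B' ro h (uo t)⟫_ℝ
      = ∫ t in (0 : ℝ)..τ, ⟪q t, B (ro + (0 : ℝ) • h) (v t) + B' ro h (uo t)⟫_ℝ := by
    refine intervalIntegral.integral_congr fun t ht => ?_
    rw [uIcc_of_le hτ] at ht
    simp only [hq t ht, zero_smul, add_zero]
  rw [hpq]
  linarith

/-- The fundamental lemma of the calculus of variations in `L²`, tested against `q` itself. -/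
theorem ae_eq_zero_of_integral_inner_L2 {τ : ℝ} {q : ℝ → U}
    (hq : MemLp q 2 (volume.restrict (Ioc 0 τ)))
    (h : ∀ v : L2 τ U, ∫ t in Ioc 0 τ, ⟪q t, v t⟫_ℝ = 0) :
    ∀ᵐ t ∂(volume.restrict (Ioc 0 τ)), q t = 0 := by
  have h1 : ⟪hq.toLp q, hq.toLp q⟫_ℝ = 0 := by
    rw [L2.inner_def]
    refine (integral_congr_ae ?_).trans (h (hq.toLp q))
    filter_upwards [hq.coeFn_toLp] with t ht
    rw [ht]
  have h2 := inner_self_eq_zero.1 h1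
  exact (hq.toLp_eq_toLp_iff MemLp.zero).1 (h2.trans (MemLp.toLp_zero _).symm)

/-- A positive definite `R` is injective, though possibly not onto, so `R⁻¹` undoes it on its range. -/
theorem inverseOp_apply [CompleteSpace U] {R : U →L[ℝ] U} (hR : IsPositiveDefinite R) (u : U) :
    ∃ h : R u ∈ (inverseOp R).domain, inverseOp R ⟨R u, h⟩ = u := by
  have hker : ((R : U →ₗ[ℝ] U).toPMap ⊤).toFun.ker = ⊥ := by
    rw [LinearMap.ker_eq_bot']
    rintro ⟨w, hw⟩ h0
    have h1 : R w = 0 := h0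
    by_contra hne
    have h2 := hR.2 w fun h => hne (Subtype.ext h)
    rw [h1, inner_zero_left] at h2
    exact lt_irrefl _ h2
  have hmem : R u ∈ (inverseOp R).domain := by
    rw [inverseOp, LinearPMap.inverse_domain]
    exact ⟨⟨u, Submodule.mem_top⟩, rfl⟩
  exact ⟨hmem, LinearPMap.inverse_apply_eq hker (y := ⟨R u, hmem⟩)
    (x := ⟨u, Submodule.mem_top⟩) rfl⟩

end Optimality

end ActuatorDesign

theorem theorem4p1
    {X U K : Type*}
    [NormedAddCommGroup X] [InnerProductSpace ℝ X] [CompleteSpace X]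
    [TopologicalSpace.SeparableSpace X]
    [NormedAddCommGroup U] [InnerProductSpace ℝ U] [CompleteSpace U]
    [NormedAddCommGroup K] [InnerProductSpace ℝ K] [CompleteSpace K]
    (A : X →ₗ.[ℝ] X) (T : ℝ → X →L[ℝ] X) (hA : ActuatorDesign.Generates A T)
    (F : X → X) (F' : X → X →L[ℝ] X)
    (hF : ActuatorDesign.HasGateauxDeriv F F')
    (hF' : ActuatorDesign.MapsBoundedOn F' Set.univ)
    (Kad : Set K) (B : K → U →L[ℝ] X) (B' : K → K →L[ℝ] (U →L[ℝ] X))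
    (hB : ActuatorDesign.HasGateauxDerivOn B B' Kad)
    (hB' : ActuatorDesign.MapsBoundedOn B' Kad)
    (Q : X →L[ℝ] X) (hQ : Q.IsPositive)
    (R : U →L[ℝ] U) (hR : ActuatorDesign.IsPositiveDefinite R)
    (τ : ℝ) (hτ : 0 < τ) (ρ : ℝ) (x₀ : X)
    (uo : ActuatorDesign.L2 τ U) (ro : K) (xo : ℝ → X)
    (hmin : ActuatorDesign.IsLocalMinimizer T F B Q R τ ρ Kad x₀ uo ro xo)
    (hint : (uo, ro) ∈ interior (ActuatorDesign.admissibleInputs τ ρ U ×ˢ Kad))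
    (p : ℝ → X) (hp : ActuatorDesign.IsAdjointMildSolution T F' Q τ xo p) :
    (∀ᵐ t ∂(volume.restrict (Ioc 0 τ)),
      ∃ h : ((B ro)†) (p t) ∈ (ActuatorDesign.inverseOp R).domain,
        uo t = -(ActuatorDesign.inverseOp R) ⟨((B ro)†) (p t), h⟩) ∧
    IntervalIntegrable (fun t => (((B' ro).flip (uo t))†) (p t)) volume 0 τ ∧
    ∫ t in (0 : ℝ)..τ, (((B' ro).flip (uo t))†) (p t) = 0 := by
  have hRs : ∀ x y, ⟪R x, y⟫_ℝ = ⟪x, R y⟫_ℝ := fun x y => by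
    conv_lhs => rw [← ContinuousLinearMap.isSelfAdjoint_iff'.1 hR.1]
    exact ContinuousLinearMap.adjoint_inner_left R y x
  have key := ActuatorDesign.variational_identity hA.1 hF hF' hB hQ.inner_left_eq_inner_right
    hRs hτ.le hmin hint hp
  obtain ⟨C, hC⟩ := isCompact_Icc.exists_bound_of_continuousOn hp.1
  have hpm : AEStronglyMeasurable p (volume.restrict (Ioc 0 τ)) :=
    (hp.1.mono Ioc_subset_Icc_self).aestronglyMeasurable measurableSet_Ioc
  have hpC : ∀ᵐ t ∂(volume.restrict (Ioc 0 τ)), ‖p t‖ ≤ C := by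
    filter_upwards [ae_restrict_mem measurableSet_Ioc] with t ht
    exact hC t (Ioc_subset_Icc_self ht)
  have hui : Integrable (fun t => uo t) (volume.restrict (Ioc 0 τ)) :=
    (intervalIntegrable_iff_integrableOn_Ioc_of_le hτ.le).1
      (ActuatorDesign.intervalIntegrable_L2 hτ.le uo)
  have hBp : MemLp (fun t => ((B ro)†) (p t)) 2 (volume.restrict (Ioc 0 τ)) :=
    (((B ro)†).comp_memLp' (MemLp.of_bound hpm C hpC) :)
  have hRu : MemLp (fun t => R (uo t)) 2 (volume.restrict (Ioc 0 τ)) :=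
    (R.comp_memLp' (Lp.memLp uo) :)
  have hgi : Integrable (fun t => (((B' ro).flip (uo t))†) (p t))
      (volume.restrict (Ioc 0 τ)) := by
    refine Integrable.mono' (hui.norm.const_mul (‖(B' ro).flip‖ * C)) ?_ ?_
    · have h1 : AEStronglyMeasurable (fun t => ((B' ro).flip (uo t))†)
          (volume.restrict (Ioc 0 τ)) :=
        (ContinuousLinearMap.adjoint.continuous.comp
          (B' ro).flip.continuous).comp_aestronglyMeasurable hui.1
      exact isBoundedBilinearMap_apply.continuous.comp_aestronglyMeasurable (h1.prodMk hpm)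
    · filter_upwards [hpC] with t ht
      calc ‖(((B' ro).flip (uo t))†) (p t)‖ ≤ ‖((B' ro).flip (uo t))†‖ * ‖p t‖ :=
            ContinuousLinearMap.le_opNorm _ _
        _ ≤ (‖(B' ro).flip‖ * ‖uo t‖) * C := by
            rw [LinearIsometryEquiv.norm_map]
            gcongr
            exact ContinuousLinearMap.le_opNorm _ _
        _ = _ := by ring
  refine ⟨?_, (intervalIntegrable_iff_integrableOn_Ioc_of_le hτ.le).2 hgi, ?_⟩
  · have hzero := ActuatorDesign.ae_eq_zero_of_integral_inner_L2 (hBp.add hRu) fun v => by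
      have h1 := key v 0
      have hpB : IntervalIntegrable (fun t => ⟪p t, B ro (v t)⟫_ℝ) volume 0 τ := by
        rw [intervalIntegrable_iff_integrableOn_Ioc_of_le hτ.le]
        refine (L2.integrable_inner (𝕜 := ℝ) (hBp.toLp _) v).congr ?_
        filter_upwards [hBp.coeFn_toLp] with t ht
        rw [ht, ContinuousLinearMap.adjoint_inner_left]
      simp only [map_zero, zero_apply, add_zero] at h1
      rw [← intervalIntegral.integral_add hpB
        (ActuatorDesign.intervalIntegrable_inner_L2 hτ.le R uo v),
        intervalIntegral.integral_of_le hτ.le] at h1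
      refine (integral_congr_ae (ae_of_all _ fun t => ?_)).trans h1
      simp only [Pi.add_apply, inner_add_left, ContinuousLinearMap.adjoint_inner_left]
    filter_upwards [hzero] with t ht
    have h1 : ((B ro)†) (p t) = R (-uo t) := by
      rw [map_neg]; exact eq_neg_of_add_eq_zero_left ht
    obtain ⟨h2, h3⟩ := ActuatorDesign.inverseOp_apply hR (-uo t)
    simp only [h1]
    exact ⟨h2, by rw [h3, neg_neg]⟩
  · refine ext_inner_right ℝ fun h => ?_
    rw [inner_zero_left, real_inner_comm, intervalIntegral.integral_of_le hτ.le,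
      ← integral_inner hgi]
    have h1 := key 0 h
    have hv0 : ∀ᵐ t ∂(volume.restrict (Ioc 0 τ)), (0 : ActuatorDesign.L2 τ U) t = 0 :=
      Lp.coeFn_zero _ _ _
    have e1 : ∫ t in (0 : ℝ)..τ, ⟪R (uo t), (0 : ActuatorDesign.L2 τ U) t⟫_ℝ = 0 := by
      rw [intervalIntegral.integral_of_le hτ.le]
      refine integral_eq_zero_of_ae ?_
      filter_upwards [hv0] with t ht
      rw [ht, inner_zero_right, Pi.zero_apply]
    rw [e1, add_zero, intervalIntegral.integral_of_le hτ.le] at h1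
    refine (integral_congr_ae ?_).trans h1
    filter_upwards [hv0] with t ht
    rw [ht, map_zero, zero_add, ContinuousLinearMap.adjoint_inner_right,
      ContinuousLinearMap.flip_apply, real_inner_comm]
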